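/- Let $d\in\mathbb N$, let $\mathbb T^d=(\mathbb R/\mathbb Z)^d$, and let $\kappa\in\{-1,0,1\}$. Consider the equation $$\partial_t f+p\cdot\nabla_x(f+\kappa f^2)=\operatorname{div}_p\big(\nabla_p f+p(f+\kappa f^2)\big),\qquad f(0,x,p)=f_0(x,p),$$ for $t\ge 0$, $x\in\mathbb T^d$, $p\in\mathbb R^d$. A global weak solution with (locally integrable) initial condition $f_0$ is a real-valued function $f\in C([0,\infty),L^1\cap L^2(\mathbb T^d\times\mathbb R^d))$ such that $$\int_0^\infty\!\int_{\mathbb T^d}\int_{\mathbb R^d} f\big[\partial_t\varphi+(1+\kappa f)\,p\cdot\nabla_x\varphi-(1+\kappa f)\,p\cdot\nabla_p\varphi+\Delta_p\varphi\big]\,dp\,dx\,dt+\int_{\mathbb T^d}\int_{\mathbb R^d}\varphi|_{t=0}\,f_0\,dp\,dx=0$$ for all $\varphi\in C_c^\infty([0,\infty)\times\mathbb T^d\times\mathbb R^d)$. Let $f$ and $g$ be two global weak solutions with initial conditions $f_0$ and $g_0$ respectively, and assume that the weak gradients satisfy $$\nabla_x f,\ \nabla_p f,\ \nabla_x g,\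 \nabla_p g\in L^2_{loc}([0,\infty),L^1\cap L^2(\mathbb T^d\times\mathbb R^d)).$$ Then $$\|f(t)-g(t)\|_{L^1(\mathbb T^d\times\mathbb R^d)}\le\|f_0-g_0\|_{L^1(\mathbb T^d\times\mathbb R^d)}\qquad\text{for all } t\ge 0 .$$ -/

import Mathlib

open MeasureTheory Set Filter Topology
open scoped ContDiff

namespace QFP

/-- The flat torus `(ℝ/ℤ)^d`; its `volume` is Lebesgue measure, of total mass one. -/
abbrev Torus (d : ℕ) : Type := Fin d → UnitAddCircle

/-- The momentum space `ℝ^d`. -/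
abbrev Mom (d : ℕ) : Type := EuclideanSpace ℝ (Fin d)

/-- The phase space of points `(x, p)`, with the product Lebesgue measure `volume`. -/
abbrev Phase (d : ℕ) : Type := Torus d × Mom d

/-- The covering map `ℝ^d → (ℝ/ℤ)^d`. -/
def toTorus {d : ℕ} (y : Fin d → ℝ) : Torus d := fun i => (y i : UnitAddCircle)

/-- The classical partial derivative `∂ψ/∂x_i`. -/
noncomputable def partialX {d : ℕ} (i : Fin d) (ψ : Phase d → ℝ) (z : Phase d) : ℝ :=
  deriv (fun s : ℝ => ψ (z.1 + Pi.single i (s : UnitAddCircle), z.2)) 0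

/-- The classical partial derivative `∂ψ/∂p_i`. -/
noncomputable def partialP {d : ℕ} (i : Fin d) (ψ : Phase d → ℝ) (z : Phase d) : ℝ :=
  deriv (fun s : ℝ => ψ (z.1, z.2 + EuclideanSpace.single i s)) 0

/-- The classical Laplacian in the momentum variable. -/
noncomputable def laplacianP {d : ℕ} (ψ : Phase d → ℝ) (z : Phase d) : ℝ :=
  ∑ i, partialP i (partialP i ψ) z

/-- `ψ ∈ C_c^∞(T^d × ℝ^d)`. A function on the torus is smooth iff its periodic lift is. -/
def IsTest {d : ℕ} (ψ : Phase d → ℝ) : Prop :=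
  ContDiff ℝ ∞ (fun q : (Fin d → ℝ) × Mom d => ψ (toTorus q.1, q.2)) ∧ HasCompactSupport ψ

/-- `φ ∈ C_c^∞(ℝ × T^d × ℝ^d)`. The restrictions of these functions to `t ≥ 0` are the elements
of `C_c^∞([0,∞) × T^d × ℝ^d)`, functions smooth up to `t = 0` that need not vanish there. -/
def IsTimeTest {d : ℕ} (φ : ℝ → Phase d → ℝ) : Prop :=
  ContDiff ℝ ∞ (fun q : ℝ × (Fin d → ℝ) × Mom d => φ q.1 (toTorus q.2.1, q.2.2)) ∧
    HasCompactSupport (fun q : ℝ × Phase d => φ q.1 q.2)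

/-- `f ∈ C([0,∞), L¹ ∩ L²(T^d × ℝ^d))`; each `f t` is any representative of its class, and the
values for `t < 0` are irrelevant. -/
def ContL1L2 {d : ℕ} (f : ℝ → Phase d → ℝ) : Prop :=
  ∀ t : ℝ, 0 ≤ t → MemLp (f t) 1 volume ∧ MemLp (f t) 2 volume ∧
    Tendsto (fun s => eLpNorm (f s - f t) 1 volume) (𝓝[Ici 0] t) (𝓝 0) ∧
    Tendsto (fun s => eLpNorm (f s - f t) 2 volume) (𝓝[Ici 0] t) (𝓝 0)

/-- `u` is the weak derivative of `h` on phase space with respect to the coordinate whose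
classical partial derivative is `D`. -/
def IsWeakDeriv {d : ℕ} (D : (Phase d → ℝ) → Phase d → ℝ) (h u : Phase d → ℝ) : Prop :=
  ∀ ψ : Phase d → ℝ, IsTest ψ → ∫ z, h z * D ψ z = - ∫ z, u z * ψ z

/-- The weak derivative of `f` with respect to the coordinate whose classical partial derivative
is `D` exists and belongs to `L²_loc([0,∞), L¹ ∩ L²(T^d × ℝ^d))`. -/
def HasRegularDeriv {d : ℕ} (D : (Phase d → ℝ) → Phase d → ℝ) (f : ℝ → Phase d → ℝ) : Prop :=
  ∃ u : ℝ → Phase d → ℝ,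
    AEStronglyMeasurable (fun q : ℝ × Phase d => u q.1 q.2)
      ((volume.restrict (Ioi (0 : ℝ))).prod volume) ∧
    (∀ᵐ t ∂(volume.restrict (Ioi (0 : ℝ))),
      MemLp (u t) 1 volume ∧ MemLp (u t) 2 volume ∧ IsWeakDeriv D (f t) (u t)) ∧
    ∀ T : ℝ, 0 < T →
      ∫⁻ t in Ioc 0 T, (eLpNorm (u t) 1 volume) ^ 2 < ⊤ ∧
      ∫⁻ t in Ioc 0 T, (eLpNorm (u t) 2 volume) ^ 2 < ⊤

/-- `∇_x f` and `∇_p f` belong to `L²_loc([0,∞), L¹ ∩ L²(T^d × ℝ^d))`. -/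
def RegularGradients {d : ℕ} (f : ℝ → Phase d → ℝ) : Prop :=
  ∀ i : Fin d, HasRegularDeriv (partialX i) f ∧ HasRegularDeriv (partialP i) f

/-- `f` is a global weak solution, with initial condition `f₀`, of
`∂_t f + p · ∇_x (f + κ f²) = div_p (∇_p f + p (f + κ f²))`. The local integrability of `f₀`
gives a meaning to the initial term; the other term is defined by the continuity of `f`. -/
def IsWeakSolution {d : ℕ} (κ : ℝ) (f₀ : Phase d → ℝ) (f : ℝ → Phase d → ℝ) : Prop :=
  ContL1L2 f ∧ LocallyIntegrable f₀ volume ∧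
  ∀ φ : ℝ → Phase d → ℝ, IsTimeTest φ →
    (∫ t in Ioi (0 : ℝ), ∫ z : Phase d,
        f t z * (deriv (fun s => φ s z) t
          + (1 + κ * f t z) * ∑ i, z.2 i * partialX i (φ t) z
          - (1 + κ * f t z) * ∑ i, z.2 i * partialP i (φ t) z
          + laplacianP (φ t) z))
      + ∫ z : Phase d, φ 0 z * f₀ z = 0

end QFP

/-!
# `L¹` contraction for weak solutions of the kinetic Fokker-Planck equation with quadratic flux

Put `k(r) = r + κ r²` (`flux`), so that both the transport and the friction act on `k(f)`. The
difference of two solutions is tested against `sign (f - g)`. The diffusion has a sign by convexity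
of the absolute value, and since `k(f) - k(g) = (f - g) (1 + κ (f + g))`, the product
`sign (f - g) ∇(k(f) - k(g))` is the gradient of `|f - g| (1 + κ (f + g))`. The transport
and friction terms therefore form the divergence of `|f - g| (1 + κ (f + g))` times the field
`(-p, p)`, whose integral vanishes. Hence `∫ |f - g|` does not increase. No pointwise bound on the
solutions is needed, because the solutions and their weak gradients are in `L²`.

To make this rigorous, a solution is mollified in `(x, p)` by convolution with `approxUnit n`. The
mollified solution satisfies pointwise an integrated equation in time (`IsWeakSolution.conv_eq`),
whose right-hand side differs from the equation for the mollified function by the commutators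
`commErr`. These tend to zero in `L¹` on the support of a cutoff, because the weak chain rule
(`IsRegular.isWeakDeriv_flux`) identifies the gradient of `k(f)` as an `L¹` function. The absolute
value is replaced by `√(r² + ε²)`, which keeps the sign of the diffusion (`integral_diffusion_le`)
and costs an error of order `ε` in the transport (`integral_transport_le`). At a fixed time this gives `integral_evol_le`, with a bound
quadratic in the norms of `f`, `g` and their gradients. These norms are square integrable in time,
so dominated convergence yields the estimate `ofReal_integral_cutoff_le` with a cutoff `χ`.

The remaining error is `η` times a constant independent of the cutoff, where `η` bounds both `∇χ`
and `p ∇χ`. The logarithmic cutoffs `logCutoff R`, functions of `log (1 + |p|²) / R`, have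
`η = c / R`, which tends to zero although the field `p` is unbounded. Finally the initial condition
is attained almost everywhere (`IsWeakSolution.initial_ae_eq`).
-/

namespace QFP

variable {d : ℕ}

/-! ### Coordinate derivatives and smooth functions on phase space -/

instance : (volume : Measure (Phase d)).IsAddHaarMeasure :=
  Measure.prod.instIsAddHaarMeasure volume volume

/-- Translation by `s` in the coordinate direction `k`: the position directions are `inl i`, the
momentum directions are `inr i`. -/
noncomputable def shift (k : Fin d ⊕ Fin d) (s : ℝ) : Phase d :=
  Sum.elim (fun i => (Pi.single i (s : UnitAddCircle), 0))
    (fun i => (0, EuclideanSpace.single i s)) k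

/-- The classical partial derivative in the coordinate direction `k`, treating `partialX` and
`partialP` uniformly. -/
noncomputable def dirDeriv (k : Fin d ⊕ Fin d) (ψ : Phase d → ℝ) (z : Phase d) : ℝ :=
  deriv (fun s : ℝ => ψ (z + shift k s)) 0

lemma partialX_eq (i : Fin d) : partialX (d := d) i = dirDeriv (Sum.inl i) := by
  funext ψ z
  simp only [partialX, dirDeriv, shift, Sum.elim_inl, Prod.add_def, add_zero]

lemma partialP_eq (i : Fin d) : partialP (d := d) i = dirDeriv (Sum.inr i) := by
  funext ψ z
  simp only [partialP, dirDeriv, shift, Sum.elim_inr, Prod.add_def, add_zero]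

lemma shift_add (k : Fin d ⊕ Fin d) (s t : ℝ) : shift k (s + t) = shift k s + shift k t := by
  rcases k with i | i
  · simp [shift, Pi.single_add]
  · simp only [shift, Sum.elim_inr, Prod.mk_add_mk, add_zero, Prod.mk.injEq, true_and]
    ext j
    by_cases h : j = i <;> simp [h]

@[simp] lemma shift_zero (k : Fin d ⊕ Fin d) : shift k 0 = 0 := by
  have := shift_add k 0 0
  simpa using this

lemma shift_neg (k : Fin d ⊕ Fin d) (s : ℝ) : shift k (-s) = -shift k s := by
  rw [eq_neg_iff_add_eq_zero, ← shift_add]; simp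

@[fun_prop] lemma continuous_shift (k : Fin d ⊕ Fin d) : Continuous (shift k) := by
  rcases k with i | i
  · have h : Continuous fun s : ℝ => (Pi.single i (s : UnitAddCircle) : Torus d) :=
      (continuous_single i).comp (AddCircle.continuous_mk' 1)
    exact h.prodMk continuous_const
  · have h : Continuous fun s : ℝ => EuclideanSpace.single i s :=
      (PiLp.continuous_toLp 2 fun _ : Fin d => ℝ).comp
        (continuous_single (A := fun _ : Fin d => ℝ) i)
    exact continuous_const.prodMk h

/-- `F'` is the everywhere defined classical derivative of `F` in the direction `k`. -/
def HasDir (k : Fin d ⊕ Fin d) (F F' : Phase d → ℝ) : Prop :=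
  ∀ z, HasDerivAt (fun s : ℝ => F (z + shift k s)) (F' z) 0

namespace HasDir

variable {k : Fin d ⊕ Fin d} {F F' G G' : Phase d → ℝ}

lemma dirDeriv_eq (h : HasDir k F F') : dirDeriv k F = F' := by
  funext z; exact (h z).deriv

lemma hasDerivAt (h : HasDir k F F') (z : Phase d) (s : ℝ) :
    HasDerivAt (fun s : ℝ => F (z + shift k s)) (F' (z + shift k s)) s := by
  have h1 := h (z + shift k s)
  have h2 : HasDerivAt (fun t : ℝ => F (z + shift k s + shift k (t - s)))
      (F' (z + shift k s)) s := by
    have := HasDerivAt.comp_sub_const (f := fun t : ℝ => F (z + shift k s + shift k t)) s s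
      (by rw [sub_self]; exact h1)
    simpa using this
  refine h2.congr_of_eventuallyEq (Eventually.of_forall fun t => ?_)
  simp only [add_assoc, ← shift_add]
  congr 3; ring

lemma add (hF : HasDir k F F') (hG : HasDir k G G') :
    HasDir k (fun z => F z + G z) (fun z => F' z + G' z) := fun z => (hF z).add (hG z)

lemma sub (hF : HasDir k F F') (hG : HasDir k G G') :
    HasDir k (fun z => F z - G z) (fun z => F' z - G' z) := fun z => (hF z).sub (hG z)

lemma const_mul (c : ℝ) (hF : HasDir k F F') :
    HasDir k (fun z => c * F z) (fun z => c * F' z) := fun z => (hF z).const_mul c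

lemma const (c : ℝ) : HasDir k (fun _ => c) (fun _ => 0) := fun _ => hasDerivAt_const _ _

lemma mul (hF : HasDir k F F') (hG : HasDir k G G') :
    HasDir k (fun z => F z * G z) (fun z => F' z * G z + F z * G' z) := fun z => by
  have := (hF z).fun_mul (hG z)
  simpa using this

lemma comp {φ φ' : ℝ → ℝ} (hφ : ∀ r, HasDerivAt φ (φ' r) r) (hF : HasDir k F F') :
    HasDir k (fun z => φ (F z)) (fun z => φ' (F z) * F' z) := fun z => by
  have := HasDerivAt.comp (h₂ := φ) (0 : ℝ) (hφ _) (hF z)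
  simpa [Function.comp_def] using this

/-- By translation invariance of the volume, the integral of a derivative vanishes: integrate
`F (z + shift k 1) - F z = ∫₀¹ F' (z + shift k s) ds` over phase space. -/
lemma integral_eq_zero (h : HasDir k F F') (hF : Integrable F) (hF' : Integrable F')
    (hc : Continuous F') : ∫ z, F' z = 0 := by
  have hint : Integrable (fun q : ℝ × Phase d => F' (q.2 + shift k q.1))
      ((volume.restrict (Ioc (0 : ℝ) 1)).prod volume) := by
    rw [integrable_prod_iff (by
      apply Continuous.aestronglyMeasurable; fun_prop)]
    refine ⟨Eventually.of_forall fun s => hF'.comp_add_right (shift k s), ?_⟩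
    have : (fun s : ℝ => ∫ y : Phase d, ‖F' (y + shift k s)‖) = fun _ => ∫ y, ‖F' y‖ := by
      funext s
      exact integral_add_right_eq_self (fun y => ‖F' y‖) _
    simp only [this]
    exact integrable_const _
  have h1 : ∀ z, F (z + shift k 1) - F z = ∫ s in (0 : ℝ)..1, F' (z + shift k s) := by
    intro z
    rw [intervalIntegral.integral_eq_sub_of_hasDerivAt (fun s _ => h.hasDerivAt z s)]
    · simp
    · apply Continuous.intervalIntegrable; fun_prop
  have h2 : ∫ z, (F (z + shift k 1) - F z) = 0 := by
    rw [integral_sub (hF.comp_add_right _) hF, integral_add_right_eq_self, sub_self]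
  simp only [h1, intervalIntegral.integral_of_le zero_le_one] at h2
  rw [← integral_integral_swap (f := fun s z => F' (z + shift k s)) hint] at h2
  simpa [integral_add_right_eq_self F'] using h2

lemma eq_zero_of_notMem_tsupport (h : HasDir k F F') {z : Phase d} (hz : z ∉ tsupport F) :
    F' z = 0 := by
  have h0 : F =ᶠ[𝓝 (z + shift k 0)] 0 := by
    rw [shift_zero, add_zero]; exact notMem_tsupport_iff_eventuallyEq.mp hz
  have hc : Continuous fun s : ℝ => z + shift k s := by fun_prop
  have h1 := hc.continuousAt.eventually h0
  have h2 := (h z).congr_of_eventuallyEq (f₁ := fun _ => 0) (by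
    filter_upwards [h1] with s hs; simp [hs])
  exact h2.unique (hasDerivAt_const _ _)

lemma hasCompactSupport (h : HasDir k F F') (hF : HasCompactSupport F) :
    HasCompactSupport F' :=
  HasCompactSupport.intro hF fun _ hz => h.eq_zero_of_notMem_tsupport hz

end HasDir

/-- The map from the covering space `ℝ^d × ℝ^d` to phase space. -/
def cover (q : (Fin d → ℝ) × Mom d) : Phase d := (toTorus q.1, q.2)

/-- Smoothness of a function on phase space, that is, of its periodic lift. -/
def IsSmooth (ψ : Phase d → ℝ) : Prop := ContDiff ℝ ∞ fun q => ψ (cover q)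

lemma isOpenQuotientMap_cover : IsOpenQuotientMap (cover (d := d)) := by
  have h : IsOpenQuotientMap (toTorus (d := d)) := by
    have : IsOpenQuotientMap (fun y : ℝ => (y : UnitAddCircle)) :=
      QuotientAddGroup.isOpenQuotientMap_mk
    exact IsOpenQuotientMap.piMap fun _ => this
  exact h.prodMap IsOpenQuotientMap.id

/-- The unit vector in the direction `k` of the covering space. -/
noncomputable def unitVec (k : Fin d ⊕ Fin d) : (Fin d → ℝ) × Mom d :=
  Sum.elim (fun i => (Pi.single i 1, 0)) (fun i => (0, EuclideanSpace.single i 1)) k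

lemma cover_add_smul (q : (Fin d → ℝ) × Mom d) (k : Fin d ⊕ Fin d) (s : ℝ) :
    cover (q + s • unitVec k) = cover q + shift k s := by
  rcases k with i | i
  · simp only [cover, unitVec, shift, Sum.elim_inl, Prod.ext_iff]
    refine ⟨?_, by simp⟩
    funext j
    by_cases h : j = i
    · subst h; simp [toTorus]
    · simp [h, toTorus]
  · simp only [cover, unitVec, shift, Sum.elim_inr, Prod.ext_iff]
    refine ⟨by simp, ?_⟩
    ext j
    by_cases h : j = i <;> simp [h]

namespace IsSmooth

variable {ψ φ : Phase d → ℝ}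

lemma continuous (h : IsSmooth ψ) : Continuous ψ :=
  isOpenQuotientMap_cover.isQuotientMap.continuous_iff.mpr (ContDiff.continuous h)

lemma hasDir_aux (h : IsSmooth ψ) (k : Fin d ⊕ Fin d) (q : (Fin d → ℝ) × Mom d) :
    HasDerivAt (fun s : ℝ => ψ (cover q + shift k s))
      (fderiv ℝ (fun q => ψ (cover q)) q (unitVec k)) 0 := by
  have h1 : HasFDerivAt (fun q => ψ (cover q)) (fderiv ℝ (fun q => ψ (cover q)) q)
      (q + (0 : ℝ) • unitVec k) := by
    rw [zero_smul, add_zero]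
    exact (ContDiff.differentiable h (by simp) q).hasFDerivAt
  have h2 : HasDerivAt (fun s : ℝ => q + s • unitVec k) (unitVec k) 0 := by
    simpa using ((hasDerivAt_id (0 : ℝ)).smul_const (unitVec k)).const_add q
  have := h1.comp_hasDerivAt (0 : ℝ) h2
  simpa only [Function.comp_def, cover_add_smul] using this

lemma hasDir (h : IsSmooth ψ) (k : Fin d ⊕ Fin d) : HasDir k ψ (dirDeriv k ψ) := by
  intro z
  obtain ⟨q, rfl⟩ := isOpenQuotientMap_cover.surjective z
  have := h.hasDir_aux k q
  rwa [← this.deriv] at this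

lemma dirDeriv (h : IsSmooth ψ) (k : Fin d ⊕ Fin d) : IsSmooth (dirDeriv k ψ) := by
  have : (fun q => QFP.dirDeriv k ψ (cover q)) =
      fun q => fderiv ℝ (fun q => ψ (cover q)) q (unitVec k) := by
    funext q; exact (h.hasDir_aux k q).deriv
  unfold IsSmooth
  rw [this]
  exact (ContDiff.fderiv_right (m := ∞) h (by simp)).clm_apply contDiff_const

lemma mul (h : IsSmooth ψ) (h' : IsSmooth φ) : IsSmooth fun z => ψ z * φ z := ContDiff.mul h h'

lemma add (h : IsSmooth ψ) (h' : IsSmooth φ) : IsSmooth fun z => ψ z + φ z := ContDiff.add h h'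

lemma const (c : ℝ) : IsSmooth fun _ : Phase d => c := contDiff_const

lemma comp {g : ℝ → ℝ} (hg : ContDiff ℝ ∞ g) (h : IsSmooth ψ) : IsSmooth fun z => g (ψ z) :=
  ContDiff.comp hg h

lemma coord (i : Fin d) : IsSmooth fun z : Phase d => z.2 i := by
  unfold IsSmooth cover
  fun_prop

lemma const_sub (h : IsSmooth ψ) (z : Phase d) : IsSmooth fun y => ψ (z - y) := by
  obtain ⟨q, rfl⟩ := isOpenQuotientMap_cover.surjective z
  have : (fun y => ψ (cover q - cover y)) = fun y => ψ (cover (q - y)) := by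
    funext y
    congr 1
  unfold IsSmooth
  rw [this]
  exact ContDiff.comp (g := fun q => ψ (cover q)) h (contDiff_const.sub contDiff_id)

end IsSmooth

lemma HasDir.const_sub {k : Fin d ⊕ Fin d} {F F' : Phase d → ℝ} (h : HasDir k F F')
    (z : Phase d) : HasDir k (fun y => F (z - y)) (fun y => - F' (z - y)) := fun y => by
  have := HasDerivAt.scomp (0 : ℝ) (g₁ := fun s : ℝ => F (z - y + shift k s)) (h := fun s => -s)
    (by rw [neg_zero]; exact h (z - y)) (hasDerivAt_neg 0)
  simp only [Function.comp_def, shift_neg, smul_eq_mul, neg_mul, one_mul] at this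
  have e : (fun s : ℝ => F (z - (y + shift k s))) = fun s => F (z - y + -shift k s) := by
    funext s; congr 1; abel
  rw [← e] at this
  exact this

lemma HasDir.comp_sub {k : Fin d ⊕ Fin d} {F F' : Phase d → ℝ} (h : HasDir k F F')
    (y : Phase d) : HasDir k (fun z => F (z - y)) (fun z => F' (z - y)) := fun z => by
  have e : (fun s : ℝ => F (z + shift k s - y)) = fun s => F (z - y + shift k s) := by
    funext s; congr 1; abel
  rw [e]
  exact h (z - y)

/-- The momentum coordinate that goes with the direction `k`. -/
def coord (k : Fin d ⊕ Fin d) (z : Phase d) : ℝ := z.2 (Sum.elim id id k)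

/-- The derivative of `coord k` in the direction `k`: one in the momentum directions. -/
def divg (k : Fin d ⊕ Fin d) : ℝ := Sum.elim (fun _ => 0) (fun _ => 1) k

lemma isSmooth_coord (k : Fin d ⊕ Fin d) : IsSmooth (coord k) := IsSmooth.coord _

lemma hasDir_coord (k : Fin d ⊕ Fin d) : HasDir k (coord k) (fun _ => divg k) := by
  intro z
  rcases k with i | i
  · simpa [coord, shift, divg] using hasDerivAt_const (0 : ℝ) (z.2 i)
  · simpa [coord, shift, divg] using (hasDerivAt_id (0 : ℝ)).const_add (z.2 i)

namespace IsTest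

variable {ψ φ : Phase d → ℝ}

lemma isSmooth (h : IsTest ψ) : IsSmooth ψ := h.1

lemma continuous (h : IsTest ψ) : Continuous ψ := h.isSmooth.continuous

lemma integrable (h : IsTest ψ) : Integrable ψ := h.continuous.integrable_of_hasCompactSupport h.2

lemma hasDir (h : IsTest ψ) (k : Fin d ⊕ Fin d) : HasDir k ψ (dirDeriv k ψ) := h.isSmooth.hasDir k

lemma dirDeriv (h : IsTest ψ) (k : Fin d ⊕ Fin d) : IsTest (dirDeriv k ψ) :=
  ⟨h.isSmooth.dirDeriv k, (h.hasDir k).hasCompactSupport h.2⟩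

lemma mul_left (h : IsTest ψ) (h' : IsSmooth φ) : IsTest fun z => φ z * ψ z :=
  ⟨h'.mul h.isSmooth, h.2.mul_left⟩

lemma const_sub (h : IsTest ψ) (z : Phase d) : IsTest fun y => ψ (z - y) :=
  ⟨h.isSmooth.const_sub z, h.2.comp_homeomorph (Homeomorph.subLeft z)⟩

lemma exists_bound (h : IsTest ψ) : ∃ C, 0 < C ∧ ∀ z, |ψ z| ≤ C := by
  obtain ⟨C, hC⟩ := h.2.exists_bound_of_continuous h.continuous
  exact ⟨max C 1, by positivity, fun z => (hC z).trans (le_max_left _ _)⟩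

end IsTest

/-! ### Convolution and mollifiers -/

instance : (volume : Measure (Phase d)).Regular :=
  Measure.Regular.of_sigmaCompactSpace_of_isLocallyFiniteMeasure _

/-- The convolution `u ⋆ τ` on phase space. -/
noncomputable def conv (u τ : Phase d → ℝ) (z : Phase d) : ℝ := ∫ y, u y * τ (z - y)

lemma conv_eq_convolution (u τ : Phase d → ℝ) :
    conv u τ = convolution u τ (ContinuousLinearMap.mul ℝ ℝ) volume := by
  funext z; rfl

lemma conv_swap (u τ : Phase d → ℝ) (z : Phase d) : conv u τ z = ∫ y, u (z - y) * τ y := by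
  rw [conv, ← integral_sub_left_eq_self _ _ z]
  simp

lemma integrable_conv_integrand {u τ : Phase d → ℝ} (hu : Integrable u) (hτ : IsTest τ)
    (z : Phase d) : Integrable fun y => u y * τ (z - y) := by
  obtain ⟨C, -, hC⟩ := hτ.exists_bound
  exact hu.mul_bdd (c := C) (hτ.const_sub z).continuous.aestronglyMeasurable
    (Eventually.of_forall fun y => hC _)

lemma continuous_conv {u τ : Phase d → ℝ} (hu : Integrable u) (hτ : IsTest τ) :
    Continuous (conv u τ) := by
  rw [conv_eq_convolution]
  exact hτ.2.continuous_convolution_right _ hu.locallyIntegrable hτ.continuous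

lemma integrable_conv {u τ : Phase d → ℝ} (hu : Integrable u) (hτ : IsTest τ) :
    Integrable (conv u τ) := by
  rw [conv_eq_convolution]
  exact hu.integrable_convolution _ hτ.integrable

lemma conv_sub {u v τ : Phase d → ℝ} (hu : Integrable u) (hv : Integrable v) (hτ : IsTest τ)
    (z : Phase d) : conv (fun y => u y - v y) τ z = conv u τ z - conv v τ z := by
  rw [conv, conv, conv, ← integral_sub (integrable_conv_integrand hu hτ z)
    (integrable_conv_integrand hv hτ z)]
  simp only [sub_mul]

lemma abs_conv_le {u τ : Phase d → ℝ} {C : ℝ} (hu : Integrable u) (hC : ∀ z, |τ z| ≤ C)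
    (z : Phase d) : |conv u τ z| ≤ C * ∫ y, |u y| := by
  rw [← integral_const_mul]
  change ‖∫ y, u y * τ (z - y)‖ ≤ _
  refine norm_integral_le_of_norm_le (hu.abs.const_mul C) (Eventually.of_forall fun y => ?_)
  rw [Real.norm_eq_abs, abs_mul, mul_comm]
  exact mul_le_mul_of_nonneg_right (hC _) (abs_nonneg _)

lemma hasDir_conv {u τ : Phase d → ℝ} (hu : Integrable u) (hτ : IsTest τ)
    (k : Fin d ⊕ Fin d) : HasDir k (conv u τ) (conv u (dirDeriv k τ)) := by
  intro z
  obtain ⟨C, -, hC⟩ := (hτ.dirDeriv k).exists_bound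
  have := (hasDerivAt_integral_of_dominated_loc_of_deriv_le (μ := (volume : Measure (Phase d)))
    (F := fun s y => u y * τ (z + shift k s - y))
    (F' := fun s y => u y * dirDeriv k τ (z + shift k s - y))
    (bound := fun y => |u y| * C) (x₀ := (0 : ℝ)) (s := univ) univ_mem
    (Eventually.of_forall fun s => (integrable_conv_integrand hu hτ _).aestronglyMeasurable)
    (integrable_conv_integrand hu hτ _)
    (integrable_conv_integrand hu (hτ.dirDeriv k) _).aestronglyMeasurable
    (Eventually.of_forall fun y s _ => ?_) (hu.abs.mul_const C)
    (Eventually.of_forall fun y s _ => ?_)).2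
  · simpa [conv] using this
  · rw [Real.norm_eq_abs, abs_mul]
    exact mul_le_mul_of_nonneg_left (hC _) (abs_nonneg _)
  · exact (((hτ.hasDir k).comp_sub y).hasDerivAt z s).const_mul (u y)

/-- Young's inequality in `L¹`. -/
lemma integral_abs_conv_le {u τ : Phase d → ℝ} (hu : Integrable u) (hτ : IsTest τ) :
    ∫ z, |conv u τ z| ≤ (∫ z, |u z|) * ∫ z, |τ z| := by
  have hint := hu.convolution_integrand (ContinuousLinearMap.mul ℝ ℝ) hτ.integrable
  simp only [ContinuousLinearMap.mul_apply'] at hint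
  have habs := hint.abs
  calc ∫ z, |conv u τ z| ≤ ∫ z, ∫ y, |u y * τ (z - y)| :=
        integral_mono (integrable_conv hu hτ).abs habs.integral_prod_left
          fun z => abs_integral_le_integral_abs
    _ = ∫ y, ∫ z, |u y * τ (z - y)| := integral_integral_swap habs
    _ = ∫ y, |u y| * ∫ z, |τ z| := by
        refine integral_congr_ae (Eventually.of_forall fun y => ?_)
        simp only [abs_mul]
        rw [integral_const_mul, integral_sub_right_eq_self fun z => |τ z|]
    _ = _ := integral_mul_const _ _

/-- A weak derivative passes to a derivative of the mollification. -/
lemma IsWeakDeriv.conv_dirDeriv {k : Fin d ⊕ Fin d} {h u τ : Phase d → ℝ}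
    (hw : IsWeakDeriv (dirDeriv k) h u) (hτ : IsTest τ) :
    conv h (dirDeriv k τ) = conv u τ := by
  funext z
  have := hw _ (hτ.const_sub z)
  rw [((hτ.hasDir k).const_sub z).dirDeriv_eq] at this
  simp only [mul_neg, integral_neg, neg_inj] at this
  exact this

/-- A nonnegative test function of integral one. -/
structure IsMollifier (ρ : Phase d → ℝ) : Prop where
  isTest : IsTest ρ
  nonneg : ∀ z, 0 ≤ ρ z
  integral_eq_one : ∫ z, ρ z = 1

/-- Averaging with respect to a probability measure does not increase an `Lᵖ` bound that holds
for almost every slice; this is Jensen's inequality followed by Tonelli's theorem. -/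
lemma eLpNorm_integral_le {μ : Measure (Phase d)} [IsProbabilityMeasure μ]
    {G : Phase d → Phase d → ℝ} {p C : ENNReal} (hp1 : 1 ≤ p) (hp : p ≠ ⊤)
    (hG : AEStronglyMeasurable (Function.uncurry G) (volume.prod μ))
    (hC : ∀ᵐ y ∂μ, eLpNorm (fun z => G z y) p volume ≤ C) :
    eLpNorm (fun z => ∫ y, G z y ∂μ) p volume ≤ C := by
  have hp0 : p ≠ 0 := (one_pos.trans_le hp1).ne'
  have hq : 0 < p.toReal := ENNReal.toReal_pos hp0 hp
  rw [eLpNorm_eq_lintegral_rpow_enorm_toReal hp0 hp, one_div,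
    ENNReal.rpow_inv_le_iff hq]
  calc ∫⁻ z, ‖∫ y, G z y ∂μ‖ₑ ^ p.toReal
      ≤ ∫⁻ z, ∫⁻ y, ‖G z y‖ₑ ^ p.toReal ∂μ := by
        refine lintegral_mono_ae ?_
        filter_upwards [hG.prodMk_left] with z hz
        rw [← ENNReal.le_rpow_inv_iff hq, ← one_div,
          ← eLpNorm_eq_lintegral_rpow_enorm_toReal hp0 hp]
        refine (enorm_integral_le_lintegral_enorm _).trans ?_
        rw [← eLpNorm_one_eq_lintegral_enorm]
        exact eLpNorm_le_eLpNorm_of_exponent_le hp1 hz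
    _ = ∫⁻ y, (∫⁻ z, ‖G z y‖ₑ ^ p.toReal) ∂μ :=
        lintegral_lintegral_swap (hG.enorm.pow_const _)
    _ ≤ ∫⁻ _, C ^ p.toReal ∂μ := by
        refine lintegral_mono_ae ?_
        filter_upwards [hC] with y hy
        rw [← ENNReal.rpow_inv_le_iff hq, ← one_div,
          ← eLpNorm_eq_lintegral_rpow_enorm_toReal hp0 hp]
        exact hy
    _ = C ^ p.toReal := by simp

/-- The probability measure with density `ρ`. -/
noncomputable def IsMollifier.measure (ρ : Phase d → ℝ) : Measure (Phase d) :=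
  volume.withDensity fun z => ENNReal.ofReal (ρ z)

namespace IsMollifier

variable {ρ : Phase d → ℝ}

lemma isProbabilityMeasure (hρ : IsMollifier ρ) :
    IsProbabilityMeasure (IsMollifier.measure ρ) := by
  refine ⟨?_⟩
  rw [IsMollifier.measure, withDensity_apply _ MeasurableSet.univ, Measure.restrict_univ,
    ← ofReal_integral_eq_lintegral_ofReal hρ.isTest.integrable (Eventually.of_forall hρ.nonneg),
    hρ.integral_eq_one, ENNReal.ofReal_one]

lemma integral_measure (hρ : IsMollifier ρ) (F : Phase d → ℝ) :
    ∫ y, F y ∂(IsMollifier.measure ρ) = ∫ y, F y * ρ y := by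
  rw [IsMollifier.measure, integral_withDensity_eq_integral_toReal_smul
    hρ.isTest.continuous.measurable.ennreal_ofReal (by simp)]
  refine integral_congr_ae (Eventually.of_forall fun y => ?_)
  simp [ENNReal.toReal_ofReal (hρ.nonneg y), mul_comm]

lemma absolutelyContinuous (ρ : Phase d → ℝ) : IsMollifier.measure ρ ≪ volume :=
  withDensity_absolutelyContinuous _ _

lemma ae_measure_of_forall (hρ : IsMollifier ρ) {P : Phase d → Prop}
    (h : ∀ y, ρ y ≠ 0 → P y) : ∀ᵐ y ∂(IsMollifier.measure ρ), P y := by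
  rw [IsMollifier.measure, ae_withDensity_iff hρ.isTest.continuous.measurable.ennreal_ofReal]
  refine Eventually.of_forall fun y hy => h y fun h0 => hy ?_
  simp [h0]

lemma conv_eq (hρ : IsMollifier ρ) (u : Phase d → ℝ) (z : Phase d) :
    conv u ρ z = ∫ y, u (z - y) ∂(IsMollifier.measure ρ) := by
  rw [conv_swap, hρ.integral_measure]

lemma aestronglyMeasurable_comp_sub {u : Phase d → ℝ} (hu : AEStronglyMeasurable u volume)
    (ρ : Phase d → ℝ) [SFinite (IsMollifier.measure ρ)] :
    AEStronglyMeasurable (Function.uncurry fun z y : Phase d => u (z - y))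
      (volume.prod (IsMollifier.measure ρ)) := by
  have h := hu.comp_quasiMeasurePreserving
    (quasiMeasurePreserving_sub_of_right_invariant (volume : Measure (Phase d)) volume)
  exact h.mono_ac (Measure.AbsolutelyContinuous.rfl.prod (absolutelyContinuous ρ))

lemma eLpNorm_comp_sub {u : Phase d → ℝ} {p : ENNReal} (hu : AEStronglyMeasurable u volume)
    (y : Phase d) : eLpNorm (fun z => u (z - y)) p volume = eLpNorm u p volume :=
  eLpNorm_comp_measurePreserving hu (measurePreserving_sub_right volume y)

lemma eLpNorm_conv_le (hρ : IsMollifier ρ) {u : Phase d → ℝ} {p : ENNReal} (hp1 : 1 ≤ p)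
    (hp : p ≠ ⊤) (hu : AEStronglyMeasurable u volume) :
    eLpNorm (conv u ρ) p volume ≤ eLpNorm u p volume := by
  have := hρ.isProbabilityMeasure
  simp only [show conv u ρ = fun z => ∫ y, u (z - y) ∂(IsMollifier.measure ρ) from
    funext (hρ.conv_eq u)]
  refine eLpNorm_integral_le hp1 hp (aestronglyMeasurable_comp_sub hu ρ)
    (Eventually.of_forall fun y => ?_)
  rw [eLpNorm_comp_sub hu]

lemma memLp_conv (hρ : IsMollifier ρ) {u : Phase d → ℝ} {p : ENNReal} (hp1 : 1 ≤ p)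
    (hp : p ≠ ⊤) (hu1 : Integrable u) (hu : MemLp u p) : MemLp (conv u ρ) p :=
  ⟨(continuous_conv hu1 hρ.isTest).aestronglyMeasurable,
    (hρ.eLpNorm_conv_le hp1 hp hu.1).trans_lt hu.2⟩

lemma eLpNorm_conv_sub_le (hρ : IsMollifier ρ) {u : Phase d → ℝ} {p C : ENNReal} (hp1 : 1 ≤ p)
    (hp : p ≠ ⊤) (hu : Integrable u)
    (hC : ∀ y, ρ y ≠ 0 → eLpNorm (fun z => u (z - y) - u z) p volume ≤ C) :
    eLpNorm (fun z => conv u ρ z - u z) p volume ≤ C := by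
  have := hρ.isProbabilityMeasure
  have h : (fun z => conv u ρ z - u z) =
      fun z => ∫ y, (u (z - y) - u z) ∂(IsMollifier.measure ρ) := by
    funext z
    have hi : Integrable (fun y => u (z - y)) (IsMollifier.measure ρ) := by
      rw [IsMollifier.measure, integrable_withDensity_iff_integrable_smul'
        hρ.isTest.continuous.measurable.ennreal_ofReal (by simp)]
      have h1 := (integrable_conv_integrand hu hρ.isTest z).comp_sub_left z
      refine h1.congr (Eventually.of_forall fun y => ?_)
      simp [ENNReal.toReal_ofReal (hρ.nonneg y), mul_comm]
    rw [integral_sub hi (integrable_const _), hρ.conv_eq]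
    simp
  rw [h]
  refine eLpNorm_integral_le hp1 hp ?_ (hρ.ae_measure_of_forall hC)
  exact (aestronglyMeasurable_comp_sub hu.1 ρ).sub hu.1.comp_fst

end IsMollifier

/-- Continuity of translations in `Lᵖ`. -/
lemma tendsto_eLpNorm_comp_sub {u : Phase d → ℝ} {p : ENNReal} (hp1 : 1 ≤ p) (hp : p ≠ ⊤)
    (hu : MemLp u p volume) :
    Tendsto (fun y => eLpNorm (fun z => u (z - y) - u z) p volume) (𝓝 0) (𝓝 0) := by
  have := Fact.mk hp1
  let g : Phase d → C(Phase d, Phase d) := fun y => ⟨fun z => z - y, by fun_prop⟩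
  have hg : Continuous g := by
    let G : C(Phase d × Phase d, Phase d) := ⟨fun q => q.2 - q.1, by fun_prop⟩
    exact G.curry.continuous
  have hmp : ∀ y, MeasurePreserving (g y) volume volume := fun y =>
    measurePreserving_sub_right volume y
  have h := Filter.Tendsto.compMeasurePreservingLp (f := fun _ : Phase d => hu.toLp u)
    (l := 𝓝 (0 : Phase d)) tendsto_const_nhds (hg.tendsto 0) hmp (hmp 0) hp
  rw [tendsto_iff_edist_tendsto_0] at h
  refine h.congr fun y => ?_
  rw [Lp.edist_def]
  refine eLpNorm_congr_ae ?_
  have e1 := Lp.coeFn_compMeasurePreserving (hu.toLp u) (hmp y)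
  have e2 := Lp.coeFn_compMeasurePreserving (hu.toLp u) (hmp 0)
  have e3 := (hmp y).quasiMeasurePreserving.ae_eq_comp hu.coeFn_toLp
  filter_upwards [e1, e2, e3, hu.coeFn_toLp] with z h1 h2 h3 h4
  simp only [Pi.sub_apply, h1, h2]
  simp only [Function.comp_apply] at h3 ⊢
  rw [h3]
  simp [g, h4]

/-- A sequence of mollifiers whose supports shrink to the origin. -/
structure IsApproxUnit (ρ : ℕ → Phase d → ℝ) : Prop where
  isMollifier : ∀ n, IsMollifier (ρ n)
  eventually_support : ∀ U ∈ 𝓝 (0 : Phase d), ∀ᶠ n in atTop, ∀ z, ρ n z ≠ 0 → z ∈ U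

lemma IsApproxUnit.tendsto_conv {ρ : ℕ → Phase d → ℝ} (hρ : IsApproxUnit ρ) {u : Phase d → ℝ}
    {p : ENNReal} (hp1 : 1 ≤ p) (hp : p ≠ ⊤) (hu1 : Integrable u) (hu : MemLp u p) :
    Tendsto (fun n => eLpNorm (fun z => conv u (ρ n) z - u z) p volume) atTop (𝓝 0) := by
  rw [ENNReal.tendsto_nhds_zero]
  intro ε hε
  have h := ENNReal.tendsto_nhds_zero.mp (tendsto_eLpNorm_comp_sub hp1 hp hu) ε hε
  filter_upwards [hρ.eventually_support _ h] with n hn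
  exact (hρ.isMollifier n).eLpNorm_conv_sub_le hp1 hp hu1 fun y hy => hn y hy

/-! ### Explicit mollifiers and logarithmic cutoffs -/

/-- The function `1 - cos (2πx)` on the circle. -/
noncomputable def circleGap (x : UnitAddCircle) : ℝ := 1 - (fourier 1 x).re

lemma circleGap_coe (y : ℝ) : circleGap (y : UnitAddCircle) = 1 - Real.cos (2 * Real.pi * y) := by
  rw [circleGap, fourier_coe_apply]
  have : (2 * Real.pi * Complex.I * (1 : ℤ) * y / (1 : ℝ) : ℂ)
      = ((2 * Real.pi * y : ℝ) : ℂ) * Complex.I := by push_cast; ring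
  rw [this, Complex.exp_ofReal_mul_I_re]

lemma circleGap_nonneg (x : UnitAddCircle) : 0 ≤ circleGap x := by
  induction x using QuotientAddGroup.induction_on with
  | H y => rw [circleGap_coe]; linarith [Real.cos_le_one (2 * Real.pi * y)]

lemma circleGap_eq_zero {x : UnitAddCircle} (h : circleGap x = 0) : x = 0 := by
  apply AddCircle.injective_toCircle one_ne_zero
  rw [AddCircle.toCircle_zero]
  have h1 : (fourier 1 x).re = 1 := by unfold circleGap at h; linarith
  rw [fourier_one] at h1
  have h2 := Circle.normSq_coe (AddCircle.toCircle x)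
  rw [Complex.normSq_apply, h1] at h2
  have h3 : (AddCircle.toCircle x : ℂ).im = 0 := by nlinarith
  exact Circle.ext (Complex.ext (by simpa using h1) (by simpa using h3))

lemma circleGap_zero : circleGap 0 = 0 := by
  have := circleGap_coe 0
  simpa using this

/-- A smooth proper function on phase space that vanishes at the origin only. -/
noncomputable def gap (z : Phase d) : ℝ := ∑ i, circleGap (z.1 i) + ‖z.2‖ ^ 2

lemma isSmooth_gap : IsSmooth (gap (d := d)) := by
  have : (fun q => gap (cover (d := d) q)) =
      fun q => ∑ i, (1 - Real.cos (2 * Real.pi * q.1 i)) + ‖q.2‖ ^ 2 := by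
    funext q
    simp only [gap, cover, toTorus, circleGap_coe]
  unfold IsSmooth
  rw [this]
  refine ContDiff.add (ContDiff.sum fun i _ => ?_) (contDiff_snd.norm_sq ℝ)
  exact contDiff_const.sub (Real.contDiff_cos.comp (by fun_prop))

lemma gap_nonneg (z : Phase d) : 0 ≤ gap z :=
  add_nonneg (Finset.sum_nonneg fun _ _ => circleGap_nonneg _) (by positivity)

lemma gap_zero : gap (0 : Phase d) = 0 := by simp [gap, circleGap_zero]

lemma gap_eq_zero {z : Phase d} (h : gap z = 0) : z = 0 := by
  have h1 : 0 ≤ ∑ i, circleGap (z.1 i) := Finset.sum_nonneg fun _ _ => circleGap_nonneg _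
  have h2 : 0 ≤ ‖z.2‖ ^ 2 := by positivity
  unfold gap at h
  have h3 : ∑ i, circleGap (z.1 i) = 0 := by linarith
  have h4 : ‖z.2‖ ^ 2 = 0 := by linarith
  rw [Finset.sum_eq_zero_iff_of_nonneg fun _ _ => circleGap_nonneg _] at h3
  refine Prod.ext (funext fun i => circleGap_eq_zero (h3 i (Finset.mem_univ i))) ?_
  simpa using h4

lemma isCompact_momentum_le (r : ℝ) : IsCompact {z : Phase d | ‖z.2‖ ≤ r} := by
  have : {z : Phase d | ‖z.2‖ ≤ r} = univ ×ˢ Metric.closedBall (0 : Mom d) r := by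
    ext z; simp
  rw [this]
  exact isCompact_univ.prod (isCompact_closedBall 0 r)

lemma isCompact_gap_le : IsCompact {z : Phase d | gap z ≤ 1} := by
  refine (isCompact_momentum_le 1).of_isClosed_subset
    (isClosed_le isSmooth_gap.continuous continuous_const) fun z hz => ?_
  have h1 : 0 ≤ ∑ i, circleGap (z.1 i) := Finset.sum_nonneg fun _ _ => circleGap_nonneg _
  have h2 : ‖z.2‖ ^ 2 ≤ 1 := by
    have : gap z ≤ 1 := hz
    unfold gap at this; linarith
  exact (sq_le_one_iff₀ (norm_nonneg _)).mp h2

/-- The unnormalized bump functions that concentrate at the origin. -/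
noncomputable def bump (n : ℕ) (z : Phase d) : ℝ :=
  Real.smoothTransition (1 - (n + 1) * gap z)

lemma bump_nonneg (n : ℕ) (z : Phase d) : 0 ≤ bump n z := Real.smoothTransition.nonneg _

lemma gap_lt_of_bump_ne_zero {n : ℕ} {z : Phase d} (h : bump n z ≠ 0) :
    (n + 1) * gap z < 1 := by
  by_contra! hc
  exact h (Real.smoothTransition.zero_of_nonpos (by linarith))

lemma isTest_bump (n : ℕ) : IsTest (bump (d := d) n) := by
  refine ⟨?_, HasCompactSupport.intro isCompact_gap_le fun z hz => ?_⟩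
  · exact IsSmooth.comp (g := fun r => Real.smoothTransition (1 - (n + 1) * r))
      (Real.smoothTransition.contDiff.comp (by fun_prop)) isSmooth_gap
  · by_contra hne
    have h1 := gap_lt_of_bump_ne_zero hne
    have h2 : ¬ gap z ≤ 1 := hz
    have h3 : (0 : ℝ) ≤ n := n.cast_nonneg
    nlinarith

lemma integral_bump_pos (n : ℕ) : 0 < ∫ z : Phase d, bump n z := by
  refine (isTest_bump n).continuous.integral_pos_of_hasCompactSupport_nonneg_nonzero
    (isTest_bump n).2 (bump_nonneg n) (x := 0) ?_
  simp [bump, gap_zero]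

/-- The mollifiers obtained by normalizing `bump`. -/
noncomputable def approxUnit (n : ℕ) (z : Phase d) : ℝ := (∫ y : Phase d, bump n y)⁻¹ * bump n z

lemma isApproxUnit_approxUnit : IsApproxUnit (approxUnit (d := d)) := by
  refine ⟨fun n => ⟨?_, fun z => ?_, ?_⟩, fun U hU => ?_⟩
  · exact (isTest_bump n).mul_left (IsSmooth.const _)
  · exact mul_nonneg (inv_nonneg.mpr (integral_bump_pos n).le) (bump_nonneg n z)
  · simp only [approxUnit]
    rw [integral_const_mul, inv_mul_cancel₀ (integral_bump_pos n).ne']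
  · have hK : IsCompact ({z : Phase d | gap z ≤ 1} \ interior U) :=
      isCompact_gap_le.diff isOpen_interior
    have h0 : (0 : Phase d) ∈ interior U := mem_interior_iff_mem_nhds.mpr hU
    obtain ⟨m, hm, hmK⟩ : ∃ m > 0, ∀ z ∈ {z : Phase d | gap z ≤ 1} \ interior U, m ≤ gap z := by
      rcases ({z : Phase d | gap z ≤ 1} \ interior U).eq_empty_or_nonempty with he | hne
      · exact ⟨1, one_pos, by simp [he]⟩
      · obtain ⟨z, hz, hmin⟩ := hK.exists_isMinOn hne isSmooth_gap.continuous.continuousOn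
        refine ⟨gap z, lt_of_le_of_ne (gap_nonneg z) fun h => ?_, fun y hy => hmin hy⟩
        exact hz.2 (gap_eq_zero h.symm ▸ h0)
    obtain ⟨N, hN⟩ := exists_nat_gt (1 / m)
    filter_upwards [eventually_ge_atTop N] with n hn z hz
    have hz' : bump n z ≠ 0 := fun h => hz (by simp [approxUnit, h])
    have h1 := gap_lt_of_bump_ne_zero hz'
    have h2 : (N : ℝ) ≤ n := by exact_mod_cast hn
    have h3 : (0 : ℝ) ≤ n := n.cast_nonneg
    by_contra hzU
    have h4 := hmK z ⟨by show gap z ≤ 1; nlinarith [gap_nonneg z],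
      fun h => hzU (interior_subset h)⟩
    rw [div_lt_iff₀ hm] at hN
    nlinarith [gap_nonneg z]

lemma IsApproxUnit.tendsto_integral_coord {ρ : ℕ → Phase d → ℝ} (hρ : IsApproxUnit ρ)
    (k : Fin d ⊕ Fin d) :
    Tendsto (fun n => ∫ z, |coord k z * ρ n z|) atTop (𝓝 0) := by
  rw [Metric.tendsto_nhds]
  intro ε hε
  have hU : {z : Phase d | |coord k z| < ε / 2} ∈ 𝓝 (0 : Phase d) := by
    have hc : Continuous fun z : Phase d => |coord k z| := (isSmooth_coord k).continuous.abs
    refine (isOpen_lt hc continuous_const).mem_nhds ?_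
    simpa [coord] using hε
  filter_upwards [hρ.eventually_support _ hU] with n hn
  have hm := hρ.isMollifier n
  have h1 : ∫ z, |coord k z * ρ n z| ≤ ∫ z, ε / 2 * ρ n z := by
    refine integral_mono (hm.isTest.mul_left (isSmooth_coord k)).integrable.abs
      (hm.isTest.integrable.const_mul _) fun z => ?_
    simp only [abs_mul, abs_of_nonneg (hm.nonneg z)]
    by_cases h : ρ n z = 0
    · simp [h]
    · exact mul_le_mul_of_nonneg_right (hn z h).le (hm.nonneg z)
  rw [integral_const_mul, hm.integral_eq_one] at h1
  have h2 : 0 ≤ ∫ z, |coord k z * ρ n z| := integral_nonneg fun z => abs_nonneg _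
  rw [Real.dist_eq, sub_zero, abs_of_nonneg h2]
  linarith

/-- A compactly supported cutoff with `|∂χ| ≤ η` and `|p_k ∂χ| ≤ η`. The second bound is what
makes the drift terms, whose coefficient `p` is unbounded, disappear in the limit `η → 0`. -/
structure IsCutoff (η : ℝ) (χ : Phase d → ℝ) : Prop where
  isTest : IsTest χ
  nonneg : ∀ z, 0 ≤ χ z
  le_one : ∀ z, χ z ≤ 1
  abs_dirDeriv_le : ∀ k z, |dirDeriv k χ z| ≤ η
  abs_coord_mul_le : ∀ k z, |coord k z * dirDeriv k χ z| ≤ η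

/-- The logarithmic weight `log (1 + |p|²)`. -/
noncomputable def logWeight (z : Phase d) : ℝ := Real.log (1 + ‖z.2‖ ^ 2)

lemma isSmooth_logWeight : IsSmooth (logWeight (d := d)) := by
  have h : ContDiff ℝ ∞ fun q : (Fin d → ℝ) × Mom d => 1 + ‖q.2‖ ^ 2 :=
    contDiff_const.add (contDiff_snd.norm_sq ℝ)
  exact ContDiff.log h fun q => by positivity

lemma hasDir_logWeight_inl (i : Fin d) :
    HasDir (Sum.inl i) (logWeight (d := d)) (fun _ => 0) := by
  intro z
  simpa [logWeight, shift] using hasDerivAt_const (0 : ℝ) (Real.log (1 + ‖z.2‖ ^ 2))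

lemma hasDir_logWeight_inr (i : Fin d) :
    HasDir (Sum.inr i) (logWeight (d := d)) (fun z => 2 * z.2 i / (1 + ‖z.2‖ ^ 2)) := by
  have h1 : HasDir (Sum.inr i) (fun z : Phase d => 1 + ‖z.2‖ ^ 2) (fun z => 2 * z.2 i) := by
    intro z
    have e : (fun s : ℝ => 1 + ‖(z + shift (Sum.inr i) s).2‖ ^ 2)
        = fun s => 1 + (‖z.2‖ ^ 2 + 2 * s * z.2 i + s ^ 2) := by
      funext s
      rw [Prod.snd_add, norm_add_sq_real]
      simp [shift, EuclideanSpace.inner_single_right]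
      ring
    rw [e]
    have := (((((hasDerivAt_id (0 : ℝ)).const_mul 2).mul_const (z.2 i)).const_add
      (‖z.2‖ ^ 2)).add ((hasDerivAt_id (0 : ℝ)).pow 2)).const_add 1
    simpa [Pi.add_def] using this
  intro z
  exact (h1 z).log (by positivity) |>.congr_deriv (by simp)

lemma exists_deriv_smoothTransition_bound :
    ∃ c, 0 < c ∧ ∀ r, |deriv Real.smoothTransition r| ≤ c := by
  have hc : Continuous (deriv Real.smoothTransition) :=
    (Real.smoothTransition.contDiff (n := 1)).continuous_deriv le_rfl
  have hs : HasCompactSupport (deriv Real.smoothTransition) := by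
    refine HasCompactSupport.intro (isCompact_Icc (a := (0 : ℝ)) (b := 1)) fun r hr => ?_
    rcases not_and_or.mp hr with h | h
    · have : Real.smoothTransition =ᶠ[𝓝 r] fun _ => 0 := by
        filter_upwards [Iio_mem_nhds (not_le.mp h)] with s hs
        exact Real.smoothTransition.zero_of_nonpos (le_of_lt hs)
      rw [this.deriv_eq, deriv_const]
    · have : Real.smoothTransition =ᶠ[𝓝 r] fun _ => 1 := by
        filter_upwards [Ioi_mem_nhds (not_le.mp h)] with s hs
        exact Real.smoothTransition.one_of_one_le (le_of_lt hs)
      rw [this.deriv_eq, deriv_const]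
  obtain ⟨C, hC⟩ := hs.exists_bound_of_continuous hc
  exact ⟨max C 1, by positivity, fun r => (hC r).trans (le_max_left _ _)⟩

/-- The logarithmic cutoff, equal to one where `log (1 + |p|²) ≤ R` and to zero where it is at
least `2R`. -/
noncomputable def logCutoff (R : ℝ) (z : Phase d) : ℝ :=
  Real.smoothTransition (2 - logWeight z / R)

lemma logCutoff_eq_one {R : ℝ} (hR : 0 < R) {z : Phase d} (h : logWeight z ≤ R) :
    logCutoff R z = 1 := by
  refine Real.smoothTransition.one_of_one_le ?_
  have : logWeight z / R ≤ 1 := (div_le_one hR).mpr h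
  linarith

lemma hasDir_logCutoff {k : Fin d ⊕ Fin d} {F' : Phase d → ℝ} (R : ℝ)
    (h : HasDir k logWeight F') :
    HasDir k (logCutoff R)
      (fun z => deriv Real.smoothTransition (2 - logWeight z / R) * (-1 / R) * F' z) := by
  have h1 : ∀ r, HasDerivAt (fun r => Real.smoothTransition (2 - r / R))
      (deriv Real.smoothTransition (2 - r / R) * (-1 / R)) r := by
    intro r
    have e1 : HasDerivAt Real.smoothTransition (deriv Real.smoothTransition (2 - r / R))
        (2 - r / R) :=
      ((Real.smoothTransition.contDiff (n := 1)).differentiable (by simp) _).hasDerivAt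
    have e2 : HasDerivAt (fun r => 2 - r / R) (-1 / R) r := by
      have := ((hasDerivAt_id r).div_const R).const_sub 2
      simpa [neg_div] using this
    exact e1.comp r e2
  exact h.comp h1

lemma isTest_logCutoff {R : ℝ} (hR : 0 < R) : IsTest (logCutoff (d := d) R) := by
  refine ⟨?_, HasCompactSupport.intro (isCompact_momentum_le (Real.exp (2 * R))) fun z hz => ?_⟩
  · exact IsSmooth.comp (g := fun r => Real.smoothTransition (2 - r / R))
      (Real.smoothTransition.contDiff.comp (by fun_prop)) isSmooth_logWeight
  · refine Real.smoothTransition.zero_of_nonpos ?_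
    have h1 : Real.exp (2 * R) < ‖z.2‖ := not_le.mp hz
    have h2 : 1 ≤ Real.exp (2 * R) := Real.one_le_exp (by positivity)
    have h3 : 2 * R ≤ logWeight z := by
      rw [logWeight, Real.le_log_iff_exp_le (by positivity)]
      nlinarith
    have : 2 ≤ logWeight z / R := by rw [le_div_iff₀ hR]; exact h3
    linarith

/-- The derivative of the logarithm decays like `1 / |p|`, so that `p` times the derivative of
`logCutoff R` is of order `1 / R`. -/
lemma exists_isCutoff_logCutoff :
    ∃ c, 0 < c ∧ ∀ R, 0 < R → IsCutoff (d := d) (c / R) (logCutoff R) := by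
  obtain ⟨c, hc, hb⟩ := exists_deriv_smoothTransition_bound
  refine ⟨2 * c, by positivity, fun R hR => ?_⟩
  have hle : ∀ (i : Fin d) (z : Phase d), |z.2 i| ≤ ‖z.2‖ := fun i z => PiLp.norm_apply_le z.2 i
  have key : ∀ (r y : ℝ), |y| ≤ 2 → |deriv Real.smoothTransition r * (-1 / R) * y| ≤ 2 * c / R := by
    intro r y hy
    rw [abs_mul, abs_mul, abs_div, abs_neg, abs_one, abs_of_pos hR]
    calc |deriv Real.smoothTransition r| * (1 / R) * |y| ≤ c * (1 / R) * 2 := by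
          gcongr; exact hb r
      _ = 2 * c / R := by ring
  refine ⟨isTest_logCutoff hR, fun z => Real.smoothTransition.nonneg _,
    fun z => Real.smoothTransition.le_one _, fun k z => ?_, fun k z => ?_⟩
  · rcases k with i | i
    · rw [(hasDir_logCutoff R (hasDir_logWeight_inl i)).dirDeriv_eq]; simp; positivity
    · rw [(hasDir_logCutoff R (hasDir_logWeight_inr i)).dirDeriv_eq]
      refine key _ _ ?_
      rw [abs_div, abs_mul, abs_two, abs_of_pos (by positivity : 0 < 1 + ‖z.2‖ ^ 2),
        div_le_iff₀ (by positivity)]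
      nlinarith [hle i z, sq_nonneg (‖z.2‖ - 1)]
  · rcases k with i | i
    · rw [(hasDir_logCutoff R (hasDir_logWeight_inl i)).dirDeriv_eq]; simp; positivity
    · rw [(hasDir_logCutoff R (hasDir_logWeight_inr i)).dirDeriv_eq, mul_left_comm]
      refine key _ _ ?_
      rw [abs_mul, abs_div, abs_mul, abs_two, abs_of_pos (by positivity : 0 < 1 + ‖z.2‖ ^ 2),
        mul_div_assoc', div_le_iff₀ (by positivity)]
      simp only [coord, Sum.elim_inr, id_eq]
      nlinarith [hle i z, abs_nonneg (z.2 i)]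

/-! ### Limits in `Lᵖ` and the chain rule for the flux -/

/-- Convergence in `Lᵖ` of concrete functions along a filter. -/
structure LpTendsto {ι : Type*} (p : ENNReal) (l : Filter ι) (F : ι → Phase d → ℝ)
    (G : Phase d → ℝ) : Prop where
  memLp : ∀ i, MemLp (F i) p volume
  memLp_lim : MemLp G p volume
  tendsto : Tendsto (fun i => eLpNorm (fun z => F i z - G z) p volume) l (𝓝 0)

lemma integral_abs_eq_toReal {F : Phase d → ℝ} (hF : Integrable F) :
    ∫ z, |F z| = (eLpNorm F 1 volume).toReal := by
  rw [eLpNorm_one_eq_lintegral_enorm]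
  exact integral_norm_eq_lintegral_enorm hF.1

lemma eLpNorm_one_mul_le {f g : Phase d → ℝ} (hf : MemLp f 2) (hg : MemLp g 2) :
    eLpNorm (fun z => f z * g z) 1 volume ≤ eLpNorm f 2 volume * eLpNorm g 2 volume := by
  have h := eLpNorm_smul_le_mul_eLpNorm (p := 2) (q := 2) (r := 1) hg.1 hf.1
  rwa [Pi.smul_def'] at h

lemma memLp_one_mul {f g : Phase d → ℝ} (hf : MemLp f 2) (hg : MemLp g 2) :
    MemLp (fun z => f z * g z) 1 volume :=
  memLp_one_iff_integrable.mpr (hf.integrable_mul hg)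

lemma integral_abs_mul_le {f g : Phase d → ℝ} (hf : MemLp f 2) (hg : MemLp g 2) :
    ∫ z, |f z * g z| ≤ (eLpNorm f 2 volume).toReal * (eLpNorm g 2 volume).toReal := by
  rw [integral_abs_eq_toReal (F := fun z => f z * g z) (hf.integrable_mul hg), ← ENNReal.toReal_mul]
  exact ENNReal.toReal_mono (ENNReal.mul_ne_top hf.2.ne hg.2.ne) (eLpNorm_one_mul_le hf hg)

namespace LpTendsto

variable {ι : Type*} {p : ENNReal} {l : Filter ι} {F F' : ι → Phase d → ℝ} {G G' : Phase d → ℝ}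

lemma add (hp : 1 ≤ p) (h : LpTendsto p l F G) (h' : LpTendsto p l F' G') :
    LpTendsto p l (fun i z => F i z + F' i z) (fun z => G z + G' z) := by
  refine ⟨fun i => (h.memLp i).add (h'.memLp i), h.memLp_lim.add h'.memLp_lim, ?_⟩
  have hs := h.tendsto.add h'.tendsto
  rw [add_zero] at hs
  refine tendsto_of_tendsto_of_tendsto_of_le_of_le tendsto_const_nhds hs (fun _ => zero_le)
    fun i => ?_
  refine le_trans (le_of_eq ?_) (eLpNorm_add_le ((h.memLp i).sub h.memLp_lim).1
    ((h'.memLp i).sub h'.memLp_lim).1 hp)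
  congr 1; funext z; simp only [Pi.add_apply]; ring

lemma const_mul (c : ℝ) (h : LpTendsto p l F G) :
    LpTendsto p l (fun i z => c * F i z) (fun z => c * G z) := by
  refine ⟨fun i => (h.memLp i).const_mul c, h.memLp_lim.const_mul c, ?_⟩
  have hs := ENNReal.Tendsto.const_mul (a := ‖c‖ₑ) h.tendsto (Or.inr enorm_ne_top)
  rw [mul_zero] at hs
  refine hs.congr fun i => ?_
  rw [← eLpNorm_const_smul]
  congr 1; funext z; simp only [Pi.smul_apply, smul_eq_mul]; ring

lemma mul {f g : Phase d → ℝ} (h : LpTendsto 2 l F f) (h' : LpTendsto 2 l F' g) :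
    LpTendsto 1 l (fun i z => F i z * F' i z) (fun z => f z * g z) := by
  refine ⟨fun i => memLp_one_mul (h.memLp i) (h'.memLp i),
    memLp_one_mul h.memLp_lim h'.memLp_lim, ?_⟩
  have t1 := ENNReal.Tendsto.mul h.tendsto (Or.inr ENNReal.zero_ne_top) h'.tendsto
    (Or.inr ENNReal.zero_ne_top)
  have t2 := ENNReal.Tendsto.const_mul (a := eLpNorm f 2 volume) h'.tendsto
    (Or.inr h.memLp_lim.2.ne)
  have t3 := ENNReal.Tendsto.mul_const (b := eLpNorm g 2 volume) h.tendsto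
    (Or.inr h'.memLp_lim.2.ne)
  have hs := (t1.add t2).add t3
  simp only [mul_zero, zero_mul, add_zero] at hs
  refine tendsto_of_tendsto_of_tendsto_of_le_of_le tendsto_const_nhds hs (fun _ => zero_le)
    fun i => ?_
  have m1 : MemLp (fun z => F i z - f z) 2 volume := (h.memLp i).sub h.memLp_lim
  have m2 : MemLp (fun z => F' i z - g z) 2 volume := (h'.memLp i).sub h'.memLp_lim
  have e : (fun z => F i z * F' i z - f z * g z) =
      ((fun z => (F i z - f z) * (F' i z - g z)) + fun z => f z * (F' i z - g z)) +
        fun z => (F i z - f z) * g z := by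
    funext z; simp only [Pi.add_apply]; ring
  rw [e]
  refine (eLpNorm_add_le ((memLp_one_mul m1 m2).add (memLp_one_mul h.memLp_lim m2)).1
    (memLp_one_mul m1 h'.memLp_lim).1 le_rfl).trans ?_
  refine add_le_add ((eLpNorm_add_le (memLp_one_mul m1 m2).1 (memLp_one_mul h.memLp_lim m2).1
    le_rfl).trans ?_) (eLpNorm_one_mul_le m1 h'.memLp_lim)
  exact add_le_add (eLpNorm_one_mul_le m1 m2) (eLpNorm_one_mul_le h.memLp_lim m2)

lemma integrable (h : LpTendsto 1 l F G) (i : ι) : Integrable (F i) :=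
  memLp_one_iff_integrable.mp (h.memLp i)

lemma integrable_lim (h : LpTendsto 1 l F G) : Integrable G :=
  memLp_one_iff_integrable.mp h.memLp_lim

lemma tendsto_integral_abs (h : LpTendsto 1 l F G) :
    Tendsto (fun i => ∫ z, |F i z - G z|) l (𝓝 0) := by
  have := (ENNReal.tendsto_toReal ENNReal.zero_ne_top).comp h.tendsto
  refine this.congr fun i => ?_
  rw [integral_abs_eq_toReal (F := fun z => F i z - G z)
    ((h.integrable i).sub h.integrable_lim)]
  rfl

lemma tendsto_integral_abs_sub (h : LpTendsto 1 l F G) (h' : LpTendsto 1 l F' G) :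
    Tendsto (fun i => ∫ z, |F i z - F' i z|) l (𝓝 0) := by
  have hs := h.tendsto_integral_abs.add h'.tendsto_integral_abs
  rw [add_zero] at hs
  refine tendsto_of_tendsto_of_tendsto_of_le_of_le tendsto_const_nhds hs
    (fun _ => integral_nonneg fun z => abs_nonneg _) fun i => ?_
  have i1 : Integrable fun z => |F i z - G z| := ((h.integrable i).sub h.integrable_lim).abs
  have i2 : Integrable fun z => |F' i z - G z| :=
    ((h'.integrable i).sub h'.integrable_lim).abs
  rw [← integral_add i1 i2]
  refine integral_mono ((h.integrable i).sub (h'.integrable i)).abs (i1.add i2) fun z => ?_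
  have := abs_sub_le (F i z) (G z) (F' i z)
  rwa [abs_sub_comm (G z)] at this

lemma tendsto_integral_mul (h : LpTendsto 1 l F G) {ψ : Phase d → ℝ} {C : ℝ}
    (hψ : AEStronglyMeasurable ψ volume) (hC : ∀ z, |ψ z| ≤ C) :
    Tendsto (fun i => ∫ z, F i z * ψ z) l (𝓝 (∫ z, G z * ψ z)) := by
  have hm : ∀ {u : Phase d → ℝ}, Integrable u → Integrable fun z => u z * ψ z := fun hu =>
    hu.mul_bdd (c := C) hψ (Eventually.of_forall hC)
  rw [tendsto_iff_dist_tendsto_zero]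
  have hs := h.tendsto_integral_abs.mul_const C
  rw [zero_mul] at hs
  refine tendsto_of_tendsto_of_tendsto_of_le_of_le tendsto_const_nhds hs
    (fun _ => dist_nonneg) fun i => ?_
  rw [Real.dist_eq, ← integral_sub (hm (h.integrable i)) (hm h.integrable_lim),
    ← integral_mul_const]
  have hd : Integrable fun z => F i z - G z := (h.integrable i).sub h.integrable_lim
  refine abs_integral_le_integral_abs.trans (integral_mono ?_ (hd.abs.mul_const C) fun z => ?_)
  · exact ((hm (h.integrable i)).sub (hm h.integrable_lim)).abs
  · simp only [← sub_mul, abs_mul]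
    exact mul_le_mul_of_nonneg_left (hC z) (abs_nonneg _)

end LpTendsto

/-- The flux nonlinearity `r + κ r²`. -/
def flux (κ r : ℝ) : ℝ := r + κ * (r * r)

lemma hasDerivAt_flux (κ r : ℝ) : HasDerivAt (flux κ) (1 + 2 * κ * r) r := by
  have := (hasDerivAt_id r).add (((hasDerivAt_id r).mul (hasDerivAt_id r)).const_mul κ)
  refine this.congr_deriv ?_
  simp; ring

/-- A function of `L¹ ∩ L²` whose weak partial derivatives `u k` belong to `L¹ ∩ L²`. -/
structure IsRegular (f : Phase d → ℝ) (u : Fin d ⊕ Fin d → Phase d → ℝ) : Prop where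
  integrable : Integrable f
  memLp : MemLp f 2 volume
  integrable_deriv : ∀ k, Integrable (u k)
  memLp_deriv : ∀ k, MemLp (u k) 2 volume
  isWeakDeriv : ∀ k, IsWeakDeriv (dirDeriv k) f (u k)

lemma IsApproxUnit.lpTendsto_one {ρ : ℕ → Phase d → ℝ} (hρ : IsApproxUnit ρ) {u : Phase d → ℝ}
    (hu : Integrable u) : LpTendsto 1 atTop (fun n => conv u (ρ n)) u :=
  ⟨fun n => memLp_one_iff_integrable.mpr (integrable_conv hu (hρ.isMollifier n).isTest),
    memLp_one_iff_integrable.mpr hu,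
    hρ.tendsto_conv le_rfl ENNReal.one_ne_top hu (memLp_one_iff_integrable.mpr hu)⟩

lemma IsApproxUnit.lpTendsto_two {ρ : ℕ → Phase d → ℝ} (hρ : IsApproxUnit ρ) {u : Phase d → ℝ}
    (hu : Integrable u) (hu2 : MemLp u 2 volume) :
    LpTendsto 2 atTop (fun n => conv u (ρ n)) u :=
  ⟨fun n => (hρ.isMollifier n).memLp_conv one_le_two ENNReal.ofNat_ne_top hu hu2, hu2,
    hρ.tendsto_conv one_le_two ENNReal.ofNat_ne_top hu hu2⟩

lemma LpTendsto.flux {ι : Type*} {l : Filter ι} {F : ι → Phase d → ℝ} {G : Phase d → ℝ} (κ : ℝ)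
    (h1 : LpTendsto 1 l F G) (h2 : LpTendsto 2 l F G) :
    LpTendsto 1 l (fun i z => flux κ (F i z)) (fun z => flux κ (G z)) :=
  h1.add le_rfl ((h2.mul h2).const_mul κ)

/-- The weak derivative of `flux κ f`, according to the chain rule. -/
def fluxDeriv (κ : ℝ) (f u : Phase d → ℝ) (z : Phase d) : ℝ := u z + 2 * κ * (f z * u z)

lemma LpTendsto.fluxDeriv {ι : Type*} {l : Filter ι} {F U : ι → Phase d → ℝ}
    {f u : Phase d → ℝ} (κ : ℝ) (h2 : LpTendsto 2 l F f) (hu1 : LpTendsto 1 l U u)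
    (hu2 : LpTendsto 2 l U u) :
    LpTendsto 1 l (fun i => fluxDeriv κ (F i) (U i)) (fluxDeriv κ f u) :=
  hu1.add le_rfl ((h2.mul hu2).const_mul (2 * κ))

lemma integrable_flux {f : Phase d → ℝ} (κ : ℝ) (hf : Integrable f) (hf2 : MemLp f 2 volume) :
    Integrable fun z => flux κ (f z) :=
  hf.add ((hf2.integrable_mul hf2).const_mul κ)

lemma integrable_fluxDeriv {f u : Phase d → ℝ} (κ : ℝ) (hf2 : MemLp f 2 volume)
    (hu : Integrable u) (hu2 : MemLp u 2 volume) : Integrable (fluxDeriv κ f u) :=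
  hu.add ((hf2.integrable_mul hu2).const_mul (2 * κ))

namespace IsRegular

variable {f : Phase d → ℝ} {u : Fin d ⊕ Fin d → Phase d → ℝ}

lemma hasDir_conv (h : IsRegular f u) {ρ : Phase d → ℝ} (hρ : IsTest ρ) (k : Fin d ⊕ Fin d) :
    HasDir k (conv f ρ) (conv (u k) ρ) := by
  have := QFP.hasDir_conv h.integrable hρ k
  rwa [(h.isWeakDeriv k).conv_dirDeriv hρ] at this

lemma hasDir_flux_conv (h : IsRegular f u) {ρ : Phase d → ℝ} (hρ : IsTest ρ) (κ : ℝ)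
    (k : Fin d ⊕ Fin d) :
    HasDir k (fun z => flux κ (conv f ρ z)) (fluxDeriv κ (conv f ρ) (conv (u k) ρ)) := by
  have := (h.hasDir_conv hρ k).comp (hasDerivAt_flux κ)
  convert this using 2 with z
  unfold fluxDeriv; ring

lemma continuous_flux_conv (h : IsRegular f u) {ρ : Phase d → ℝ} (hρ : IsTest ρ) (κ : ℝ) :
    Continuous fun z => flux κ (conv f ρ z) := by
  have := continuous_conv h.integrable hρ
  unfold flux; fun_prop

lemma continuous_fluxDeriv_conv (h : IsRegular f u) {ρ : Phase d → ℝ} (hρ : IsTest ρ) (κ : ℝ)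
    (k : Fin d ⊕ Fin d) : Continuous (fluxDeriv κ (conv f ρ) (conv (u k) ρ)) := by
  have := continuous_conv h.integrable hρ
  have := continuous_conv (h.integrable_deriv k) hρ
  unfold fluxDeriv; fun_prop

/-- The chain rule for the flux, by passing to the limit in the mollified functions. -/
lemma isWeakDeriv_flux (h : IsRegular f u) (κ : ℝ) (k : Fin d ⊕ Fin d) :
    IsWeakDeriv (dirDeriv k) (fun z => flux κ (f z)) (fluxDeriv κ f (u k)) := by
  intro ψ hψ
  have hρ := isApproxUnit_approxUnit (d := d)
  have c1 := hρ.lpTendsto_one h.integrable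
  have c2 := hρ.lpTendsto_two h.integrable h.memLp
  have u1 := hρ.lpTendsto_one (h.integrable_deriv k)
  have u2 := hρ.lpTendsto_two (h.integrable_deriv k) (h.memLp_deriv k)
  obtain ⟨C, -, hC⟩ := hψ.exists_bound
  obtain ⟨C', -, hC'⟩ := (hψ.dirDeriv k).exists_bound
  have t1 := (c1.flux κ c2).tendsto_integral_mul
    (hψ.dirDeriv k).continuous.aestronglyMeasurable hC'
  have t2 := (c2.fluxDeriv κ u1 u2).tendsto_integral_mul hψ.continuous.aestronglyMeasurable hC
  refine tendsto_nhds_unique t1 (t2.neg.congr fun n => ?_)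
  have hn := (hρ.isMollifier n).isTest
  have hd := (h.hasDir_flux_conv hn κ k).mul (hψ.hasDir k)
  have hc1 := h.continuous_flux_conv hn κ
  have hc2 := h.continuous_fluxDeriv_conv hn κ k
  have i0 : Integrable fun z => flux κ (conv f (approxUnit n) z) * ψ z :=
    (hc1.mul hψ.continuous).integrable_of_hasCompactSupport hψ.2.mul_left
  have i1 : Integrable fun z => fluxDeriv κ (conv f (approxUnit n)) (conv (u k) (approxUnit n)) z
      * ψ z := (hc2.mul hψ.continuous).integrable_of_hasCompactSupport hψ.2.mul_left
  have i2 : Integrable fun z => flux κ (conv f (approxUnit n) z) * dirDeriv k ψ z :=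
    (hc1.mul (hψ.dirDeriv k).continuous).integrable_of_hasCompactSupport
      (hψ.dirDeriv k).2.mul_left
  have := hd.integral_eq_zero i0 (i1.add i2)
    ((hc2.mul hψ.continuous).add (hc1.mul (hψ.dirDeriv k).continuous))
  rw [integral_add i1 i2] at this
  linarith

end IsRegular

/-! ### Dissipation estimates for classical functions -/

/-- A smooth convex approximation of the absolute value. -/
noncomputable def softAbs (ε r : ℝ) : ℝ := √(r ^ 2 + ε ^ 2)

/-- The derivative of `softAbs`, a smooth approximation of the sign. -/
noncomputable def softSign (ε r : ℝ) : ℝ := r / √(r ^ 2 + ε ^ 2)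

/-- The second derivative of `softAbs`. -/
noncomputable def softCurv (ε r : ℝ) : ℝ := ε ^ 2 / √(r ^ 2 + ε ^ 2) ^ 3

lemma sqrt_sq_add_sq_pos {ε : ℝ} (hε : 0 < ε) (r : ℝ) : 0 < √(r ^ 2 + ε ^ 2) :=
  Real.sqrt_pos.mpr (by positivity)

lemma hasDerivAt_softAbs {ε : ℝ} (hε : 0 < ε) (r : ℝ) :
    HasDerivAt (softAbs ε) (softSign ε r) r := by
  have h : HasDerivAt (fun r : ℝ => r ^ 2 + ε ^ 2) (2 * r) r := by
    simpa using (hasDerivAt_pow 2 r).add_const (ε ^ 2)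
  refine (h.sqrt (by positivity)).congr_deriv ?_
  have := sqrt_sq_add_sq_pos hε r
  unfold softSign
  field_simp

lemma hasDerivAt_softSign {ε : ℝ} (hε : 0 < ε) (r : ℝ) :
    HasDerivAt (softSign ε) (softCurv ε r) r := by
  have hp := sqrt_sq_add_sq_pos hε r
  refine ((hasDerivAt_id r).div (hasDerivAt_softAbs hε r) hp.ne').congr_deriv ?_
  have hs : √(r ^ 2 + ε ^ 2) ^ 2 = r ^ 2 + ε ^ 2 := Real.sq_sqrt (by positivity)
  unfold softAbs softSign softCurv
  simp only [id]
  field_simp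
  rw [hs]; ring

lemma continuous_softSign {ε : ℝ} (hε : 0 < ε) : Continuous (softSign ε) :=
  continuous_iff_continuousAt.mpr fun r => (hasDerivAt_softSign hε r).continuousAt

lemma abs_softSign_le {ε : ℝ} (hε : 0 < ε) (r : ℝ) : |softSign ε r| ≤ 1 := by
  have hp := sqrt_sq_add_sq_pos hε r
  rw [softSign, abs_div, abs_of_pos hp, div_le_one hp]
  exact Real.abs_le_sqrt (by nlinarith)

lemma abs_le_softAbs (ε r : ℝ) : |r| ≤ softAbs ε r := Real.abs_le_sqrt (by nlinarith)

lemma softAbs_le {ε : ℝ} (hε : 0 < ε) (r : ℝ) : softAbs ε r ≤ |r| + ε := by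
  refine Real.sqrt_le_iff.mpr ⟨by positivity, ?_⟩
  nlinarith [sq_abs r, abs_nonneg r]

lemma abs_softSign_mul_sub_le {ε : ℝ} (hε : 0 < ε) (r : ℝ) :
    |softSign ε r * r - softAbs ε r| ≤ ε := by
  have hp := sqrt_sq_add_sq_pos hε r
  have hs : √(r ^ 2 + ε ^ 2) ^ 2 = r ^ 2 + ε ^ 2 := Real.sq_sqrt (by positivity)
  have e : softSign ε r * r - softAbs ε r = - (ε ^ 2 / √(r ^ 2 + ε ^ 2)) := by
    unfold softAbs softSign
    field_simp
    rw [hs]; ring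
  rw [e, abs_neg, abs_of_nonneg (by positivity), div_le_iff₀ hp]
  have : ε ≤ √(r ^ 2 + ε ^ 2) := Real.le_sqrt_of_sq_le (by nlinarith)
  nlinarith

lemma continuous_softAbs (ε : ℝ) : Continuous (softAbs ε) := by unfold softAbs; fun_prop

lemma continuous_softCurv {ε : ℝ} (hε : 0 < ε) : Continuous (softCurv ε) :=
  Continuous.div continuous_const (by fun_prop) fun r => (pow_pos (sqrt_sq_add_sq_pos hε r) 3).ne'

lemma softCurv_nonneg (ε r : ℝ) : 0 ≤ softCurv ε r := by unfold softCurv; positivity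

/-- The sign with which the derivative in the direction `k` enters the equation: transport in
the position directions, friction in the momentum directions. -/
def orient (k : Fin d ⊕ Fin d) : ℝ := Sum.elim (fun _ => -1) (fun _ => 1) k

lemma abs_orient (k : Fin d ⊕ Fin d) : |orient k| = 1 := by
  rcases k with i | i <;> simp [orient]

lemma orient_mul_divg (k : Fin d ⊕ Fin d) : orient k * divg k = divg k := by
  rcases k with i | i <;> simp [orient, divg]

lemma divg_nonneg (k : Fin d ⊕ Fin d) : 0 ≤ divg k := by
  rcases k with i | i <;> simp [divg]

lemma divg_le_one (k : Fin d ⊕ Fin d) : divg k ≤ 1 := by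
  rcases k with i | i <;> simp [divg]

/-- A common bound for the `L¹` and `L²` norms of a function and of its derivatives. With `1 ≤ S`,
all the estimates can be stated in terms of `S ^ 2`. -/
structure BoundedBy (S : ℝ) (f : Phase d → ℝ) (u : Fin d ⊕ Fin d → Phase d → ℝ) : Prop where
  one_le : 1 ≤ S
  norm_one : ∫ z, |f z| ≤ S
  norm_two : (eLpNorm f 2 volume).toReal ≤ S
  norm_one_deriv : ∀ k, ∫ z, |u k z| ≤ S
  norm_two_deriv : ∀ k, (eLpNorm (u k) 2 volume).toReal ≤ S

/-- A function with continuous classical first derivatives `u k` and continuous pure second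
momentum derivatives `l i`, with the integrability needed below. -/
structure IsClassical (f : Phase d → ℝ) (u : Fin d ⊕ Fin d → Phase d → ℝ)
    (l : Fin d → Phase d → ℝ) : Prop where
  continuous : Continuous f
  integrable : Integrable f
  memLp : MemLp f 2 volume
  hasDir : ∀ k, HasDir k f (u k)
  continuous_deriv : ∀ k, Continuous (u k)
  integrable_deriv : ∀ k, Integrable (u k)
  hasDir_deriv : ∀ i, HasDir (Sum.inr i) (u (Sum.inr i)) (l i)
  continuous_second : ∀ i, Continuous (l i)

/-- Constants attached to a cutoff, which may deteriorate as the cutoff is removed. -/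
structure CutoffBound (C : ℝ) (χ : Phase d → ℝ) : Prop where
  nonneg : 0 ≤ C
  integral_le : ∫ z, χ z ≤ C
  abs_coord_le : ∀ k z, |coord k z * χ z| ≤ C
  integral_coord_le : ∀ k, ∫ z, |coord k z * dirDeriv k χ z| ≤ C

lemma exists_cutoffBound {χ : Phase d → ℝ} (hχ : IsTest χ) : ∃ C, CutoffBound C χ := by
  have h1 : ∀ k, ∃ C, 0 < C ∧ ∀ z, |coord k z * χ z| ≤ C := fun k =>
    (hχ.mul_left (isSmooth_coord k)).exists_bound
  choose c hc hcb using h1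
  have hc' : ∀ k, 0 ≤ ∫ z, |coord k z * dirDeriv k χ z| := fun k =>
    integral_nonneg fun z => abs_nonneg _
  have s1 : 0 ≤ ∑ k, c k := Finset.sum_nonneg fun k _ => (hc k).le
  have s2 : 0 ≤ ∑ k, ∫ z, |coord k z * dirDeriv k χ z| := Finset.sum_nonneg fun k _ => hc' k
  have s3 := abs_nonneg (∫ z, χ z)
  refine ⟨|∫ z, χ z| + ∑ k, c k + ∑ k, ∫ z, |coord k z * dirDeriv k χ z|, by positivity, ?_,
    fun k z => ?_, fun k => ?_⟩
  · linarith [le_abs_self (∫ z, χ z)]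
  · have := Finset.single_le_sum (fun k _ => (hc k).le) (Finset.mem_univ k)
    linarith [hcb k z]
  · have := Finset.single_le_sum (fun k _ => hc' k) (Finset.mem_univ k)
    linarith

lemma integrable_of_tsupport {χ F : Phase d → ℝ} (hχ : HasCompactSupport χ)
    (hF : Continuous F) (h0 : ∀ z, z ∉ tsupport χ → F z = 0) : Integrable F :=
  hF.integrable_of_hasCompactSupport (HasCompactSupport.intro hχ h0)

section Estimates

variable {κ η C ε S : ℝ} {f g χ : Phase d → ℝ} {u v : Fin d ⊕ Fin d → Phase d → ℝ}
  {l m : Fin d → Phase d → ℝ}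

lemma integral_abs_sub_le (hf : Integrable f) (hg : Integrable g) :
    ∫ z, |f z - g z| ≤ (∫ z, |f z|) + ∫ z, |g z| := by
  rw [← integral_add hf.abs hg.abs]
  exact integral_mono (hf.sub hg).abs (hf.abs.add hg.abs) fun z => abs_sub (f z) (g z)

/-- The diffusion term: convexity of `softAbs` gives the good sign. -/
lemma integral_diffusion_le (hχ : IsCutoff η χ) (hε : 0 < ε) (hf : IsClassical f u l)
    (hg : IsClassical g v m) (hfS : BoundedBy S f u) (hgS : BoundedBy S g v) (i : Fin d) :
    ∫ z, softSign ε (f z - g z) * χ z * (l i z - m i z) ≤ 2 * η * S := by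
  have cf := hf.continuous
  have cg := hg.continuous
  have cu := hf.continuous_deriv (Sum.inr i)
  have cv := hg.continuous_deriv (Sum.inr i)
  have cl := hf.continuous_second i
  have cm := hg.continuous_second i
  have cχ := hχ.isTest.continuous
  have cDχ := (hχ.isTest.dirDeriv (Sum.inr i)).continuous
  have cs := continuous_softSign hε
  have cs' := continuous_softCurv hε
  have hχ0 : ∀ z, z ∉ tsupport χ → χ z = 0 := fun z => image_eq_zero_of_notMem_tsupport
  have hDχ0 : ∀ z, z ∉ tsupport χ → dirDeriv (Sum.inr i) χ z = 0 := fun z hz =>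
    (hχ.isTest.hasDir _).eq_zero_of_notMem_tsupport hz
  have hd := ((((hf.hasDir (Sum.inr i)).sub (hg.hasDir (Sum.inr i))).comp
    (hasDerivAt_softSign hε)).mul (hχ.isTest.hasDir (Sum.inr i))).mul
    ((hf.hasDir_deriv i).sub (hg.hasDir_deriv i))
  have hη : 0 ≤ η := (abs_nonneg _).trans (hχ.abs_dirDeriv_le (Sum.inr i) 0)
  have i0 := integrable_of_tsupport hχ.isTest.2
    (F := fun z => softSign ε (f z - g z) * χ z * (u (Sum.inr i) z - v (Sum.inr i) z))
    (by fun_prop) (fun z hz => by simp [hχ0 z hz])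
  have i1 := integrable_of_tsupport hχ.isTest.2
    (F := fun z => softSign ε (f z - g z) * χ z * (l i z - m i z))
    (by fun_prop) (fun z hz => by simp [hχ0 z hz])
  have i2 : Integrable fun z => η * |u (Sum.inr i) z - v (Sum.inr i) z| :=
    ((hf.integrable_deriv _).sub (hg.integrable_deriv _)).abs.const_mul η
  have h0 := hd.integral_eq_zero i0 (integrable_of_tsupport hχ.isTest.2 (by fun_prop)
    (fun z hz => by simp [hχ0 z hz, hDχ0 z hz])) (by fun_prop)
  have h1 : ∫ z, (softSign ε (f z - g z) * χ z * (l i z - m i z)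
      - η * |u (Sum.inr i) z - v (Sum.inr i) z|) ≤ 0 := by
    rw [← h0]
    refine integral_mono (i1.sub i2) (integrable_of_tsupport hχ.isTest.2 (by fun_prop)
      (fun z hz => by simp [hχ0 z hz, hDχ0 z hz])) fun z => ?_
    have e1 : 0 ≤ softCurv ε (f z - g z) * χ z *
        (u (Sum.inr i) z - v (Sum.inr i) z) ^ 2 :=
      mul_nonneg (mul_nonneg (softCurv_nonneg _ _) (hχ.nonneg z)) (sq_nonneg _)
    have e2 : -(softSign ε (f z - g z) * dirDeriv (Sum.inr i) χ z *
        (u (Sum.inr i) z - v (Sum.inr i) z)) ≤ η * |u (Sum.inr i) z - v (Sum.inr i) z| := by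
      refine (neg_le_abs _).trans ?_
      rw [abs_mul, abs_mul]
      refine mul_le_mul_of_nonneg_right ?_ (abs_nonneg _)
      calc |softSign ε (f z - g z)| * |dirDeriv (Sum.inr i) χ z| ≤ 1 * η :=
            mul_le_mul (abs_softSign_le hε _) (hχ.abs_dirDeriv_le _ _) (abs_nonneg _) zero_le_one
        _ = η := one_mul η
    dsimp only
    nlinarith
  rw [integral_sub i1 i2, integral_const_mul] at h1
  have h2 := integral_abs_sub_le (hf.integrable_deriv (Sum.inr i))
    (hg.integrable_deriv (Sum.inr i))
  have h3 := hfS.norm_one_deriv (Sum.inr i)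
  have h4 := hgS.norm_one_deriv (Sum.inr i)
  nlinarith

/-- The pointwise bound behind `integral_transport_le`. -/
lemma transport_pointwise_le {F G U V c X D o q w Φ E : ℝ} (hκ : |κ| ≤ 1) (hε : 0 < ε)
    (ho : |o| = 1) (hq0 : 0 ≤ q) (hq1 : q ≤ 1) (hX0 : 0 ≤ X) (hX1 : X ≤ 1)
    (hcX : |c * X| ≤ C) (hcD : |c * D| ≤ η) (hΦ0 : |w| ≤ Φ) (hΦ : Φ ≤ |w| + ε) (hE : |E| ≤ ε) :
    -(Φ * (1 + κ * (F + G)) * (o * (c * D)))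
        + E * (o * (c * X) * (κ * (U + V)) + q * X * (1 + κ * (F + G)))
      ≤ η * (|w| + |w * F| + |w * G|)
        + ε * (|c * D| + (η + 1) * (|F| + |G|) + C * (|U| + |V|) + X) := by
  have ha : ∀ x y : ℝ, |κ * (x + y)| ≤ |x| + |y| := fun x y => by
    rw [abs_mul]
    calc |κ| * |x + y| ≤ 1 * (|x| + |y|) :=
          mul_le_mul hκ (abs_add_le x y) (abs_nonneg _) zero_le_one
      _ = _ := one_mul _
  have ha1 : |1 + κ * (F + G)| ≤ 1 + (|F| + |G|) := by
    refine (abs_add_le _ _).trans ?_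
    rw [abs_one]; linarith [ha F G]
  have t1 : -(Φ * (1 + κ * (F + G)) * (o * (c * D)))
      ≤ (|w| + ε) * (1 + (|F| + |G|)) * |c * D| := by
    refine (neg_le_abs _).trans ?_
    rw [abs_mul, abs_mul, abs_mul o, ho, one_mul,
      abs_of_nonneg ((abs_nonneg w).trans hΦ0)]
    gcongr
  have t2 : E * (o * (c * X) * (κ * (U + V)) + q * X * (1 + κ * (F + G)))
      ≤ ε * (C * (|U| + |V|) + (X + (|F| + |G|))) := by
    refine (le_abs_self _).trans ?_
    rw [abs_mul]
    refine mul_le_mul hE ((abs_add_le _ _).trans (add_le_add ?_ ?_)) (abs_nonneg _) hε.le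
    · rw [abs_mul, abs_mul o, ho, one_mul]
      exact mul_le_mul hcX (ha U V) (abs_nonneg _) ((abs_nonneg _).trans hcX)
    · rw [abs_mul, abs_mul, abs_of_nonneg hq0, abs_of_nonneg hX0]
      have hqX : q * X ≤ X := by nlinarith
      have hqX1 : q * X ≤ 1 := by nlinarith
      have hqX0 : 0 ≤ q * X := mul_nonneg hq0 hX0
      have hFG : 0 ≤ |F| + |G| := by positivity
      calc q * X * |1 + κ * (F + G)| ≤ q * X * (1 + (|F| + |G|)) :=
            mul_le_mul_of_nonneg_left ha1 hqX0
        _ ≤ X + (|F| + |G|) := by nlinarith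
  have t3 : (|w| + ε) * (1 + (|F| + |G|)) * |c * D|
      ≤ η * (|w| + |w * F| + |w * G|) + ε * |c * D| + ε * η * (|F| + |G|) := by
    have h1 : |w| * (1 + (|F| + |G|)) * |c * D| ≤ |w| * (1 + (|F| + |G|)) * η :=
      mul_le_mul_of_nonneg_left hcD (by positivity)
    have h2 : ε * (|F| + |G|) * |c * D| ≤ ε * (|F| + |G|) * η :=
      mul_le_mul_of_nonneg_left hcD (by positivity)
    rw [abs_mul w F, abs_mul w G]
    nlinarith
  nlinarith

/-- The transport term. Since `flux κ f - flux κ g = (f - g) * (1 + κ * (f + g))`, it is the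
derivative of `softAbs ε (f - g) * (1 + κ * (f + g))` up to an error of size `ε`. -/
lemma integral_transport_le (hκ : |κ| ≤ 1) (hχ : IsCutoff η χ) (hC : CutoffBound C χ)
    (hηC : η ≤ C) (hε : 0 < ε) (hf : IsClassical f u l) (hg : IsClassical g v m)
    (hfS : BoundedBy S f u) (hgS : BoundedBy S g v) (k : Fin d ⊕ Fin d) :
    ∫ z, softSign ε (f z - g z) * χ z *
        (orient k * coord k z * (fluxDeriv κ f (u k) z - fluxDeriv κ g (v k) z)
          + divg k * (flux κ (f z) - flux κ (g z)))
      ≤ 6 * η * S ^ 2 + 8 * ε * (C + 1) * S ^ 2 := by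
  have cf := hf.continuous
  have cg := hg.continuous
  have cu := hf.continuous_deriv k
  have cv := hg.continuous_deriv k
  have cχ := hχ.isTest.continuous
  have cDχ := (hχ.isTest.dirDeriv k).continuous
  have cs := continuous_softSign hε
  have ca := continuous_softAbs ε
  have cc := (isSmooth_coord k).continuous
  have hχ0 : ∀ z, z ∉ tsupport χ → χ z = 0 := fun z => image_eq_zero_of_notMem_tsupport
  have hDχ0 : ∀ z, z ∉ tsupport χ → dirDeriv k χ z = 0 := fun z hz =>
    (hχ.isTest.hasDir _).eq_zero_of_notMem_tsupport hz
  have hη : 0 ≤ η := (abs_nonneg _).trans (hχ.abs_dirDeriv_le k 0)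
  have hw := (hf.hasDir k).sub (hg.hasDir k)
  have ha := (HasDir.const (k := k) (d := d) 1).add
    (((hf.hasDir k).add (hg.hasDir k)).const_mul κ)
  have hb := ((hasDir_coord k).mul (hχ.isTest.hasDir k)).const_mul (orient k)
  have hd := ((hw.comp (hasDerivAt_softAbs hε)).mul ha).mul hb
  set T : Phase d → ℝ := fun z =>
    -(softAbs ε (f z - g z) * (1 + κ * (f z + g z)) * (orient k * (coord k z * dirDeriv k χ z)))
      + (softSign ε (f z - g z) * (f z - g z) - softAbs ε (f z - g z)) *
        (orient k * (coord k z * χ z) * (κ * (u k z + v k z))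
          + divg k * χ z * (1 + κ * (f z + g z))) with hT
  have iT : Integrable T := integrable_of_tsupport hχ.isTest.2 (by fun_prop)
    (fun z hz => by simp [hT, hχ0 z hz, hDχ0 z hz])
  have h0 := hd.integral_eq_zero (integrable_of_tsupport hχ.isTest.2 (by fun_prop)
    (fun z hz => by simp [hχ0 z hz])) (integrable_of_tsupport hχ.isTest.2 (by fun_prop)
    (fun z hz => by simp [hχ0 z hz, hDχ0 z hz])) (by fun_prop)
  have iL : Integrable fun z => softSign ε (f z - g z) * χ z *
        (orient k * coord k z * (fluxDeriv κ f (u k) z - fluxDeriv κ g (v k) z)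
          + divg k * (flux κ (f z) - flux κ (g z))) := by
    unfold fluxDeriv flux
    exact integrable_of_tsupport hχ.isTest.2 (by fun_prop)
      (fun z hz => by simp [hχ0 z hz])
  have hLT : ∫ z, softSign ε (f z - g z) * χ z *
        (orient k * coord k z * (fluxDeriv κ f (u k) z - fluxDeriv κ g (v k) z)
          + divg k * (flux κ (f z) - flux κ (g z))) = ∫ z, T z := by
    rw [← sub_eq_zero, ← integral_sub iL iT, ← h0]
    refine integral_congr_ae (Eventually.of_forall fun z => ?_)
    simp only [hT, fluxDeriv, flux]
    linear_combination (-(softAbs ε (f z - g z) * (1 + κ * (f z + g z)) * χ z)) *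
      orient_mul_divg k
  have iw : Integrable fun z => |f z - g z| := (hf.integrable.sub hg.integrable).abs
  have mw : MemLp (fun z => f z - g z) 2 volume := hf.memLp.sub hg.memLp
  have iwf : Integrable fun z => |(f z - g z) * f z| := (mw.integrable_mul hf.memLp).abs
  have iwg : Integrable fun z => |(f z - g z) * g z| := (mw.integrable_mul hg.memLp).abs
  have icD : Integrable fun z => |coord k z * dirDeriv k χ z| :=
    ((hχ.isTest.dirDeriv k).mul_left (isSmooth_coord k)).integrable.abs
  have iF := hf.integrable.abs
  have iG := hg.integrable.abs
  have iU := (hf.integrable_deriv k).abs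
  have iV := (hg.integrable_deriv k).abs
  have iχ := hχ.isTest.integrable
  have j1 : Integrable fun z => |f z - g z| + |(f z - g z) * f z| := iw.add iwf
  have j2 : Integrable fun z => η * (|f z - g z| + |(f z - g z) * f z| + |(f z - g z) * g z|) :=
    (j1.add iwg).const_mul η
  have j3 : Integrable fun z => (η + 1) * (|f z| + |g z|) := (iF.add iG).const_mul _
  have j4 : Integrable fun z => C * (|u k z| + |v k z|) := (iU.add iV).const_mul _
  have j5 : Integrable fun z => |coord k z * dirDeriv k χ z| + (η + 1) * (|f z| + |g z|) :=
    icD.add j3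
  have j6 : Integrable fun z => |coord k z * dirDeriv k χ z| + (η + 1) * (|f z| + |g z|)
      + C * (|u k z| + |v k z|) := j5.add j4
  have j7 : Integrable fun z => ε * (|coord k z * dirDeriv k χ z| + (η + 1) * (|f z| + |g z|)
      + C * (|u k z| + |v k z|) + χ z) := (j6.add iχ).const_mul ε
  have hB : ∫ z, T z ≤ ∫ z, (η * (|f z - g z| + |(f z - g z) * f z| + |(f z - g z) * g z|)
      + ε * (|coord k z * dirDeriv k χ z| + (η + 1) * (|f z| + |g z|) + C * (|u k z| + |v k z|)
        + χ z)) := by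
    refine integral_mono iT (j2.add j7) fun z => ?_
    exact transport_pointwise_le hκ hε (abs_orient k) (divg_nonneg k) (divg_le_one k)
      (hχ.nonneg z) (hχ.le_one z) (hC.abs_coord_le k z) (hχ.abs_coord_mul_le k z)
      (abs_le_softAbs _ _) (softAbs_le hε _) (abs_softSign_mul_sub_le hε _)
  rw [integral_add j2 j7, integral_const_mul, integral_const_mul, integral_add j1 iwg,
    integral_add iw iwf, integral_add j6 iχ, integral_add j5 j4, integral_add icD j3,
    integral_const_mul, integral_const_mul, integral_add iF iG, integral_add iU iV] at hB
  rw [hLT]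
  refine hB.trans ?_
  have hS := hfS.one_le
  have b1 := (integral_abs_sub_le hf.integrable hg.integrable).trans
    (add_le_add hfS.norm_one hgS.norm_one)
  have nw : (eLpNorm (fun z => f z - g z) 2 volume).toReal ≤ 2 * S := by
    have h1 := ENNReal.toReal_mono (ENNReal.add_ne_top.mpr ⟨hf.memLp.2.ne, hg.memLp.2.ne⟩)
      (eLpNorm_sub_le (p := 2) hf.memLp.1 hg.memLp.1 one_le_two)
    rw [ENNReal.toReal_add hf.memLp.2.ne hg.memLp.2.ne] at h1
    have h2 := hfS.norm_two
    have h3 := hgS.norm_two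
    exact h1.trans (by linarith)
  have b2 : ∫ z, |(f z - g z) * f z| ≤ 2 * S * S := (integral_abs_mul_le mw hf.memLp).trans
    (mul_le_mul nw hfS.norm_two ENNReal.toReal_nonneg (by linarith))
  have b3 : ∫ z, |(f z - g z) * g z| ≤ 2 * S * S := (integral_abs_mul_le mw hg.memLp).trans
    (mul_le_mul nw hgS.norm_two ENNReal.toReal_nonneg (by linarith))
  have b4 := hC.integral_coord_le k
  have b5 := hC.integral_le
  have b6 := hfS.norm_one
  have b7 := hgS.norm_one
  have b8 := hfS.norm_one_deriv k
  have b9 := hgS.norm_one_deriv k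
  have hC0 := hC.nonneg
  have hSS : S ≤ S ^ 2 := by nlinarith
  refine add_le_add ?_ ?_
  · rw [mul_comm 6 η, mul_assoc]
    refine mul_le_mul_of_nonneg_left ?_ hη
    nlinarith
  · rw [mul_comm 8 ε, mul_assoc, mul_assoc]
    refine mul_le_mul_of_nonneg_left ?_ hε.le
    have c1 : (η + 1) * ((∫ z, |f z|) + ∫ z, |g z|) ≤ (C + 1) * (2 * S ^ 2) :=
      mul_le_mul (by linarith) (by linarith) (add_nonneg (integral_nonneg fun _ => abs_nonneg _)
        (integral_nonneg fun _ => abs_nonneg _)) (by linarith)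
    have c2 : C * ((∫ z, |u k z|) + ∫ z, |v k z|) ≤ C * (2 * S ^ 2) :=
      mul_le_mul_of_nonneg_left (by linarith) hC0
    have c3 : C ≤ C * S ^ 2 := le_mul_of_one_le_right hC0 (by nlinarith)
    nlinarith

end Estimates

/-! ### The mollified equation at a fixed time -/

/-- The right-hand side of the equation, tested against the translates `y ↦ ρ (z - y)`. The
momentum coefficient has been rewritten with `y.2 = z.2 - (z - y).2`, so that only convolutions
with test functions occur. -/
noncomputable def evol (κ : ℝ) (f ρ : Phase d → ℝ) (z : Phase d) : ℝ :=
  ∑ i, conv f (dirDeriv (Sum.inr i) (dirDeriv (Sum.inr i) ρ)) z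
    + ∑ k, orient k * (coord k z * conv (fun y => flux κ (f y)) (dirDeriv k ρ) z
      - conv (fun y => flux κ (f y)) (fun y => coord k y * dirDeriv k ρ y) z)

/-- The commutator error in direction `k` between the mollified equation and the equation for
the mollified function. -/
noncomputable def commErr (κ : ℝ) (f u ρ : Phase d → ℝ) (k : Fin d ⊕ Fin d) (z : Phase d) : ℝ :=
  orient k * (coord k z * (conv (fluxDeriv κ f u) ρ z - fluxDeriv κ (conv f ρ) (conv u ρ) z)
      - conv (fluxDeriv κ f u) (fun y => coord k y * ρ y) z)
    + divg k * (conv (fun y => flux κ (f y)) ρ z - flux κ (conv f ρ z))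

/-- A bound for the `L¹` norm of `commErr` on the support of a cutoff. -/
noncomputable def commBound (κ C : ℝ) (f u ρ : Phase d → ℝ) (k : Fin d ⊕ Fin d) : ℝ :=
  C * (∫ z, |conv (fluxDeriv κ f u) ρ z - fluxDeriv κ (conv f ρ) (conv u ρ) z|)
    + (∫ z, |fluxDeriv κ f u z|) * (∫ z, |coord k z * ρ z|)
    + ∫ z, |conv (fun y => flux κ (f y)) ρ z - flux κ (conv f ρ z)|

section
variable {κ C S : ℝ} {f ρ : Phase d → ℝ} {u : Fin d ⊕ Fin d → Phase d → ℝ}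

lemma IsRegular.isClassical (h : IsRegular f u) (hρ : IsMollifier ρ) :
    IsClassical (conv f ρ) (fun k => conv (u k) ρ)
      (fun i => conv f (dirDeriv (Sum.inr i) (dirDeriv (Sum.inr i) ρ))) where
  continuous := continuous_conv h.integrable hρ.isTest
  integrable := integrable_conv h.integrable hρ.isTest
  memLp := hρ.memLp_conv one_le_two ENNReal.ofNat_ne_top h.integrable h.memLp
  hasDir := h.hasDir_conv hρ.isTest
  continuous_deriv k := continuous_conv (h.integrable_deriv k) hρ.isTest
  integrable_deriv k := integrable_conv (h.integrable_deriv k) hρ.isTest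
  hasDir_deriv i := by
    simp only [← (h.isWeakDeriv (Sum.inr i)).conv_dirDeriv hρ.isTest]
    exact QFP.hasDir_conv h.integrable (hρ.isTest.dirDeriv _) _
  continuous_second i := continuous_conv h.integrable ((hρ.isTest.dirDeriv _).dirDeriv _)

lemma IsMollifier.integral_abs (hρ : IsMollifier ρ) : ∫ z, |ρ z| = 1 := by
  simp only [abs_of_nonneg (hρ.nonneg _), hρ.integral_eq_one]

lemma IsMollifier.integral_abs_conv_le (hρ : IsMollifier ρ) {h : Phase d → ℝ}
    (hh : Integrable h) : ∫ z, |conv h ρ z| ≤ ∫ z, |h z| := by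
  have := QFP.integral_abs_conv_le hh hρ.isTest
  rwa [hρ.integral_abs, mul_one] at this

lemma BoundedBy.conv (hS : BoundedBy S f u) (h : IsRegular f u) (hρ : IsMollifier ρ) :
    BoundedBy S (conv f ρ) (fun k => conv (u k) ρ) where
  one_le := hS.one_le
  norm_one := (hρ.integral_abs_conv_le h.integrable).trans hS.norm_one
  norm_two := (ENNReal.toReal_mono h.memLp.2.ne
    (hρ.eLpNorm_conv_le one_le_two ENNReal.ofNat_ne_top h.memLp.1)).trans hS.norm_two
  norm_one_deriv k := (hρ.integral_abs_conv_le (h.integrable_deriv k)).trans (hS.norm_one_deriv k)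
  norm_two_deriv k := (ENNReal.toReal_mono (h.memLp_deriv k).2.ne
    (hρ.eLpNorm_conv_le one_le_two ENNReal.ofNat_ne_top (h.memLp_deriv k).1)).trans
      (hS.norm_two_deriv k)

/-- By the chain rule for the flux and the product rule for `coord k * ρ`, `evol` is the right-hand
side of the equation at the mollified function, up to the commutator errors. -/
lemma evol_eq (h : IsRegular f u) (hρ : IsTest ρ) (z : Phase d) :
    evol κ f ρ z = ∑ i, conv f (dirDeriv (Sum.inr i) (dirDeriv (Sum.inr i) ρ)) z
      + ∑ k, (orient k * coord k z * fluxDeriv κ (conv f ρ) (conv (u k) ρ) z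
        + divg k * flux κ (conv f ρ z)) + ∑ k, commErr κ f (u k) ρ k z := by
  rw [evol, add_assoc, ← Finset.sum_add_distrib]
  congr 1
  refine Finset.sum_congr rfl fun k _ => ?_
  have hw := h.isWeakDeriv_flux κ k
  have hK := integrable_flux κ h.integrable h.memLp
  have hm := hρ.mul_left (isSmooth_coord k)
  have e1 := congrFun (hw.conv_dirDeriv hρ) z
  have e2 := congrFun (hw.conv_dirDeriv hm) z
  rw [((hasDir_coord k).mul (hρ.hasDir k)).dirDeriv_eq] at e2
  have e3 : conv (fun y => flux κ (f y)) (fun y => divg k * ρ y + coord k y * dirDeriv k ρ y) z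
      = divg k * conv (fun y => flux κ (f y)) ρ z
        + conv (fun y => flux κ (f y)) (fun y => coord k y * dirDeriv k ρ y) z := by
    have j1 := (integrable_conv_integrand hK hρ z).const_mul (divg k)
    have j2 := integrable_conv_integrand hK ((hρ.dirDeriv k).mul_left (isSmooth_coord k)) z
    rw [conv, conv, conv, ← integral_const_mul, ← integral_add j1 j2]
    refine integral_congr_ae (Eventually.of_forall fun y => ?_)
    dsimp only; ring
  rw [e3] at e2
  rw [commErr, e1]
  linear_combination -(orient k) * e2 + conv (fun y => flux κ (f y)) ρ z * orient_mul_divg k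

lemma continuous_commErr (h : IsRegular f u) (hρ : IsTest ρ) (κ : ℝ) (k : Fin d ⊕ Fin d) :
    Continuous (commErr κ f (u k) ρ k) := by
  have hH := integrable_fluxDeriv κ h.memLp (h.integrable_deriv k) (h.memLp_deriv k)
  have hK := integrable_flux κ h.integrable h.memLp
  have c1 := continuous_conv hH hρ
  have c2 := h.continuous_fluxDeriv_conv hρ κ k
  have c3 := continuous_conv hH (hρ.mul_left (isSmooth_coord k))
  have c4 := continuous_conv hK hρ
  have c5 := h.continuous_flux_conv hρ κ
  have c6 := (isSmooth_coord k).continuous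
  unfold commErr
  fun_prop

lemma integral_commErr_le {η : ℝ} {χ σ : Phase d → ℝ} (hχ : IsCutoff η χ) (hC : CutoffBound C χ)
    (h : IsRegular f u) (hρ : IsMollifier ρ) (k : Fin d ⊕ Fin d) (hσ : ∀ z, |σ z| ≤ 1) :
    ∫ z, σ z * χ z * commErr κ f (u k) ρ k z ≤ commBound κ C f (u k) ρ k := by
  have hH := integrable_fluxDeriv κ h.memLp (h.integrable_deriv k) (h.memLp_deriv k)
  have hK := integrable_flux κ h.integrable h.memLp
  have hm := hρ.isTest.mul_left (isSmooth_coord k)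
  have hcl := h.isClassical hρ
  have i1 : Integrable fun z => |conv (fluxDeriv κ f (u k)) ρ z
      - fluxDeriv κ (conv f ρ) (conv (u k) ρ) z| := ((integrable_conv hH hρ.isTest).sub
    (integrable_fluxDeriv κ hcl.memLp (hcl.integrable_deriv k)
      (hρ.memLp_conv one_le_two ENNReal.ofNat_ne_top (h.integrable_deriv k)
        (h.memLp_deriv k)))).abs
  have i2 := (integrable_conv hH hm).abs
  have i3 : Integrable fun z => |conv (fun y => flux κ (f y)) ρ z - flux κ (conv f ρ z)| :=
    ((integrable_conv hK hρ.isTest).sub (integrable_flux κ hcl.integrable hcl.memLp)).abs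
  have j1 := i1.const_mul C
  have hI := integral_mono_of_nonneg (f := fun z => |σ z * χ z * commErr κ f (u k) ρ k z|)
    (Eventually.of_forall fun z => abs_nonneg _) ((j1.add i2).add i3)
    (Eventually.of_forall fun z => ?_)
  · refine (le_abs_self _).trans (abs_integral_le_integral_abs.trans (hI.trans ?_))
    rw [integral_add' (j1.add i2) i3, integral_add' j1 i2, integral_const_mul, commBound]
    gcongr
    exact integral_abs_conv_le hH hm
  · simp only [Pi.add_apply, commErr]
    generalize conv (fluxDeriv κ f (u k)) ρ z
      - fluxDeriv κ (conv f ρ) (conv (u k) ρ) z = A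
    generalize conv (fluxDeriv κ f (u k)) (fun y => coord k y * ρ y) z = B
    generalize conv (fun y => flux κ (f y)) ρ z - flux κ (conv f ρ z) = D
    have hX0 := hχ.nonneg z
    have hX1 := hχ.le_one z
    rw [mul_assoc, abs_mul]
    have e : χ z * (orient k * (coord k z * A - B) + divg k * D)
        = orient k * (coord k z * χ z) * A - orient k * χ z * B + divg k * χ z * D := by ring
    rw [e]
    calc |σ z| * |orient k * (coord k z * χ z) * A - orient k * χ z * B + divg k * χ z * D|
        ≤ 1 * (|orient k * (coord k z * χ z) * A| + |orient k * χ z * B|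
          + |divg k * χ z * D|) := by
          refine mul_le_mul (hσ z) ?_ (abs_nonneg _) zero_le_one
          exact (abs_add_le _ _).trans (add_le_add (abs_sub _ _) le_rfl)
      _ = |coord k z * χ z| * |A| + χ z * |B| + divg k * χ z * |D| := by
          rw [one_mul, abs_mul, abs_mul (orient k), abs_mul _ B, abs_mul (orient k),
            abs_mul _ D, abs_mul (divg k), abs_orient, abs_of_nonneg hX0,
            abs_of_nonneg (divg_nonneg k), one_mul, one_mul]
      _ ≤ C * |A| + |B| + |D| := by
          have h1 := mul_le_mul_of_nonneg_right (hC.abs_coord_le k z) (abs_nonneg A)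
          have h2 := mul_le_mul_of_nonneg_right hX1 (abs_nonneg B)
          have h3 : divg k * χ z ≤ 1 := mul_le_one₀ (divg_le_one k) hX0 hX1
          have h4 := mul_le_mul_of_nonneg_right h3 (abs_nonneg D)
          linarith

/-- The commutator errors vanish: both terms of each difference have the same limit in `L¹`, and
the first moments of the mollifiers tend to zero. -/
lemma tendsto_commBound {ρ : ℕ → Phase d → ℝ} (hρ : IsApproxUnit ρ) (h : IsRegular f u)
    (κ C : ℝ) (k : Fin d ⊕ Fin d) :
    Tendsto (fun n => commBound κ C f (u k) (ρ n) k) atTop (𝓝 0) := by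
  have hH := integrable_fluxDeriv κ h.memLp (h.integrable_deriv k) (h.memLp_deriv k)
  have hK := integrable_flux κ h.integrable h.memLp
  have c1 := hρ.lpTendsto_one h.integrable
  have c2 := hρ.lpTendsto_two h.integrable h.memLp
  have u1 := hρ.lpTendsto_one (h.integrable_deriv k)
  have u2 := hρ.lpTendsto_two (h.integrable_deriv k) (h.memLp_deriv k)
  have t1 := ((hρ.lpTendsto_one hH).tendsto_integral_abs_sub (c2.fluxDeriv κ u1 u2)).const_mul C
  have t2 := (hρ.tendsto_integral_coord k).const_mul (∫ z, |fluxDeriv κ f (u k) z|)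
  have t3 := (hρ.lpTendsto_one hK).tendsto_integral_abs_sub (c1.flux κ c2)
  have := (t1.add t2).add t3
  simp only [mul_zero, add_zero] at this
  exact this

lemma integral_abs_fluxDeriv_le (hκ : |κ| ≤ 1) (hS : BoundedBy S f u) (h : MemLp f 2 volume)
    (hu : ∀ k, Integrable (u k)) (hu2 : ∀ k, MemLp (u k) 2 volume) (k : Fin d ⊕ Fin d) :
    ∫ z, |fluxDeriv κ f (u k) z| ≤ 3 * S ^ 2 := by
  have i1 := (hu k).abs
  have i2 : Integrable fun z => 2 * |f z * u k z| :=
    ((h.integrable_mul (hu2 k)).abs).const_mul 2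
  have h1 : ∫ z, |fluxDeriv κ f (u k) z| ≤ ∫ z, (|u k z| + 2 * |f z * u k z|) := by
    refine integral_mono (integrable_fluxDeriv κ h (hu k) (hu2 k)).abs (i1.add i2) fun z => ?_
    refine (abs_add_le _ _).trans (add_le_add le_rfl ?_)
    rw [abs_mul, abs_mul, abs_two]
    exact mul_le_mul_of_nonneg_right (by linarith) (abs_nonneg _)
  rw [integral_add i1 i2, integral_const_mul] at h1
  have h2 : ∫ z, |f z * u k z| ≤ S * S := (integral_abs_mul_le h (hu2 k)).trans
    (mul_le_mul hS.norm_two (hS.norm_two_deriv k) ENNReal.toReal_nonneg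
      (zero_le_one.trans hS.one_le))
  nlinarith [hS.norm_one_deriv k, hS.one_le]

lemma integral_abs_flux_le (hκ : |κ| ≤ 1) (hS : BoundedBy S f u) (hf : Integrable f)
    (h : MemLp f 2 volume) : ∫ z, |flux κ (f z)| ≤ 2 * S ^ 2 := by
  have i2 : Integrable fun z => |f z * f z| := (h.integrable_mul h).abs
  have h1 : ∫ z, |flux κ (f z)| ≤ ∫ z, (|f z| + |f z * f z|) := by
    refine integral_mono (integrable_flux κ hf h).abs (hf.abs.add i2) fun z => ?_
    refine (abs_add_le _ _).trans (add_le_add le_rfl ?_)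
    rw [abs_mul]
    exact mul_le_of_le_one_left (abs_nonneg _) hκ
  rw [integral_add hf.abs i2] at h1
  have h2 : ∫ z, |f z * f z| ≤ S * S := (integral_abs_mul_le h h).trans
    (mul_le_mul hS.norm_two hS.norm_two ENNReal.toReal_nonneg (zero_le_one.trans hS.one_le))
  nlinarith [hS.norm_one, hS.one_le]

/-- A bound uniform in the mollification, for dominated convergence in time. -/
lemma commBound_le {M : ℝ} (hκ : |κ| ≤ 1) (hC : 0 ≤ C) (hS : BoundedBy S f u) (h : IsRegular f u)
    (hρ : IsMollifier ρ) {k : Fin d ⊕ Fin d} (hM : ∫ z, |coord k z * ρ z| ≤ M) :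
    commBound κ C f (u k) ρ k ≤ (6 * C + 3 * M + 4) * S ^ 2 := by
  have hH := integrable_fluxDeriv κ h.memLp (h.integrable_deriv k) (h.memLp_deriv k)
  have hK := integrable_flux κ h.integrable h.memLp
  have hcl := h.isClassical hρ
  have hS' := hS.conv h hρ
  have m2 : ∀ k, MemLp (conv (u k) ρ) 2 volume := fun k =>
    hρ.memLp_conv one_le_two ENNReal.ofNat_ne_top (h.integrable_deriv k) (h.memLp_deriv k)
  have b1 := integral_abs_fluxDeriv_le hκ hS h.memLp h.integrable_deriv h.memLp_deriv k
  have b2 := integral_abs_fluxDeriv_le hκ hS' hcl.memLp hcl.integrable_deriv m2 k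
  have b3 := integral_abs_flux_le hκ hS h.integrable h.memLp
  have b4 := integral_abs_flux_le hκ hS' hcl.integrable hcl.memLp
  have b5 := hρ.integral_abs_conv_le hH
  have b6 := hρ.integral_abs_conv_le hK
  have c1 := integral_abs_sub_le (integrable_conv hH hρ.isTest)
    (integrable_fluxDeriv κ hcl.memLp (hcl.integrable_deriv k) (m2 k))
  have c2 := integral_abs_sub_le (integrable_conv hK hρ.isTest)
    (integrable_flux κ hcl.integrable hcl.memLp)
  have hM0 : 0 ≤ ∫ z, |coord k z * ρ z| := integral_nonneg fun z => abs_nonneg _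
  have d1 : C * (∫ z, |conv (fluxDeriv κ f (u k)) ρ z
      - fluxDeriv κ (conv f ρ) (conv (u k) ρ) z|) ≤ C * (6 * S ^ 2) :=
    mul_le_mul_of_nonneg_left (by linarith) hC
  have d2 : (∫ z, |fluxDeriv κ f (u k) z|) * (∫ z, |coord k z * ρ z|) ≤ 3 * S ^ 2 * M :=
    mul_le_mul b1 hM hM0 (by positivity)
  rw [commBound]
  linarith

end

/-- The estimate at a fixed time: the dissipation of `softAbs ε (f - g)` by the mollified
equations, up to errors that vanish with the cutoff parameter `η`, with `ε`, and with the
mollification. -/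
lemma integral_evol_le {κ η C ε S : ℝ} {f g χ ρ : Phase d → ℝ}
    {u v : Fin d ⊕ Fin d → Phase d → ℝ} (hκ : |κ| ≤ 1) (hχ : IsCutoff η χ)
    (hC : CutoffBound C χ) (hη : 0 ≤ η) (hηC : η ≤ C) (hε : 0 < ε) (hρ : IsMollifier ρ)
    (hf : IsRegular f u) (hg : IsRegular g v) (hfS : BoundedBy S f u) (hgS : BoundedBy S g v) :
    ∫ z, softSign ε (conv f ρ z - conv g ρ z) * χ z * (evol κ f ρ z - evol κ g ρ z)
      ≤ d * (14 * η * S ^ 2) + d * (16 * ε * (C + 1) * S ^ 2)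
        + (∑ k, commBound κ C f (u k) ρ k + ∑ k, commBound κ C g (v k) ρ k) := by
  have cf := hf.isClassical hρ
  have cg := hg.isClassical hρ
  have bf := hfS.conv hf hρ
  have bg := hgS.conv hg hρ
  have cs := continuous_softSign hε
  have cχ := hχ.isTest.continuous
  have c1 := cf.continuous
  have c2 := cg.continuous
  have hint : ∀ {F : Phase d → ℝ}, Continuous F →
      Integrable fun z => softSign ε (conv f ρ z - conv g ρ z) * χ z * F z := fun hF =>
    integrable_of_tsupport hχ.isTest.2 (by fun_prop)
      fun z hz => by simp [image_eq_zero_of_notMem_tsupport hz]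
  have e : ∀ z, softSign ε (conv f ρ z - conv g ρ z) * χ z * (evol κ f ρ z - evol κ g ρ z)
      = ∑ i, softSign ε (conv f ρ z - conv g ρ z) * χ z *
            (conv f (dirDeriv (Sum.inr i) (dirDeriv (Sum.inr i) ρ)) z
              - conv g (dirDeriv (Sum.inr i) (dirDeriv (Sum.inr i) ρ)) z)
        + ∑ k, softSign ε (conv f ρ z - conv g ρ z) * χ z *
            (orient k * coord k z * (fluxDeriv κ (conv f ρ) (conv (u k) ρ) z
              - fluxDeriv κ (conv g ρ) (conv (v k) ρ) z)
              + divg k * (flux κ (conv f ρ z) - flux κ (conv g ρ z)))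
        + (∑ k, softSign ε (conv f ρ z - conv g ρ z) * χ z * commErr κ f (u k) ρ k z
          + ∑ k, -softSign ε (conv f ρ z - conv g ρ z) * χ z * commErr κ g (v k) ρ k z) := by
    intro z
    rw [evol_eq hf hρ.isTest, evol_eq hg hρ.isTest]
    simp only [← Finset.mul_sum]
    rw [neg_mul, neg_mul, ← sub_eq_add_neg, ← mul_sub, ← mul_add, ← mul_add]
    congr 1
    rw [Finset.sum_sub_distrib]
    have : ∑ k, (orient k * coord k z * (fluxDeriv κ (conv f ρ) (conv (u k) ρ) z
              - fluxDeriv κ (conv g ρ) (conv (v k) ρ) z)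
              + divg k * (flux κ (conv f ρ z) - flux κ (conv g ρ z)))
        = ∑ k, (orient k * coord k z * fluxDeriv κ (conv f ρ) (conv (u k) ρ) z
            + divg k * flux κ (conv f ρ z))
          - ∑ k, (orient k * coord k z * fluxDeriv κ (conv g ρ) (conv (v k) ρ) z
            + divg k * flux κ (conv g ρ z)) := by
      rw [← Finset.sum_sub_distrib]
      exact Finset.sum_congr rfl fun k _ => by ring
    rw [this]
    ring
  have iA : ∀ i ∈ (Finset.univ : Finset (Fin d)), Integrable fun z =>
      softSign ε (conv f ρ z - conv g ρ z) * χ z *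
            (conv f (dirDeriv (Sum.inr i) (dirDeriv (Sum.inr i) ρ)) z
              - conv g (dirDeriv (Sum.inr i) (dirDeriv (Sum.inr i) ρ)) z) := fun i _ =>
    hint ((cf.continuous_second i).sub (cg.continuous_second i))
  have iB : ∀ k ∈ (Finset.univ : Finset (Fin d ⊕ Fin d)), Integrable fun z =>
      softSign ε (conv f ρ z - conv g ρ z) * χ z *
            (orient k * coord k z * (fluxDeriv κ (conv f ρ) (conv (u k) ρ) z
              - fluxDeriv κ (conv g ρ) (conv (v k) ρ) z)
              + divg k * (flux κ (conv f ρ z) - flux κ (conv g ρ z))) := fun k _ => by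
    have d1 := (isSmooth_coord k).continuous
    have d2 := hf.continuous_fluxDeriv_conv hρ.isTest κ k
    have d3 := hg.continuous_fluxDeriv_conv hρ.isTest κ k
    have d4 := hf.continuous_flux_conv hρ.isTest κ
    have d5 := hg.continuous_flux_conv hρ.isTest κ
    exact hint (by fun_prop)
  have iP : ∀ k ∈ (Finset.univ : Finset (Fin d ⊕ Fin d)), Integrable fun z =>
      softSign ε (conv f ρ z - conv g ρ z) * χ z * commErr κ f (u k) ρ k z := fun k _ =>
    hint (continuous_commErr hf hρ.isTest κ k)
  have iQ : ∀ k ∈ (Finset.univ : Finset (Fin d ⊕ Fin d)), Integrable fun z =>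
      -softSign ε (conv f ρ z - conv g ρ z) * χ z * commErr κ g (v k) ρ k z := fun k _ => by
    simp only [neg_mul]
    exact (hint (continuous_commErr hg hρ.isTest κ k)).neg
  simp only [e]
  have jA := integrable_finsetSum _ iA
  have jB := integrable_finsetSum _ iB
  have jP := integrable_finsetSum _ iP
  have jQ := integrable_finsetSum _ iQ
  refine ((integral_add (jA.add jB) (jP.add jQ)).trans
    (congrArg₂ (· + ·) (integral_add jA jB) (integral_add jP jQ))).trans_le ?_
  rw [integral_finsetSum _ iA, integral_finsetSum _ iB, integral_finsetSum _ iP,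
    integral_finsetSum _ iQ]
  have hS := hfS.one_le
  have s1 := Finset.sum_le_card_nsmul Finset.univ _ (2 * η * S) fun i _ =>
    integral_diffusion_le hχ hε cf cg bf bg i
  have s2 := Finset.sum_le_card_nsmul Finset.univ _ (6 * η * S ^ 2 + 8 * ε * (C + 1) * S ^ 2)
    fun k _ => integral_transport_le hκ hχ hC hηC hε cf cg bf bg k
  have s3 := Finset.sum_le_sum fun k (_ : k ∈ (Finset.univ : Finset (Fin d ⊕ Fin d))) =>
    integral_commErr_le (κ := κ) (σ := fun z => softSign ε (conv f ρ z - conv g ρ z)) hχ hC hf hρ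
      k fun z => abs_softSign_le hε _
  have s4 := Finset.sum_le_sum fun k (_ : k ∈ (Finset.univ : Finset (Fin d ⊕ Fin d))) =>
    integral_commErr_le (κ := κ) (σ := fun z => -softSign ε (conv f ρ z - conv g ρ z)) hχ hC hg hρ
      k fun z => by rw [abs_neg]; exact abs_softSign_le hε _
  simp only [Finset.card_univ, Fintype.card_sum, Fintype.card_fin, nsmul_eq_mul] at s1 s2
  push_cast at s2
  refine add_le_add ((add_le_add s1 s2).trans ?_) (add_le_add s3 s4)
  have h1 : (d : ℝ) * (2 * η * S) ≤ d * (2 * η * S ^ 2) := by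
    gcongr; nlinarith
  linarith

/-! ### Weak solutions in integrated form -/

/-- The fundamental lemma of the calculus of variations on the half-line, with the initial value
included. -/
lemma eq_add_integral_of_weak {F G : ℝ → ℝ} {F₀ : ℝ} (hF : Continuous F) (hG : Continuous G)
    (h : ∀ θ : ℝ → ℝ, ContDiff ℝ ∞ θ → HasCompactSupport θ →
      (∫ t in Ioi (0 : ℝ), (deriv θ t * F t + θ t * G t)) + θ 0 * F₀ = 0) :
    ∀ t, 0 ≤ t → F t = F₀ + ∫ s in (0 : ℝ)..t, G s := by
  set K : ℝ → ℝ := fun t => F₀ + ∫ s in (0 : ℝ)..t, G s with hK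
  have hKd : ∀ t, HasDerivAt K (G t) t := fun t =>
    (intervalIntegral.integral_hasDerivAt_right (hG.intervalIntegrable _ _)
      (hG.stronglyMeasurableAtFilter _ _) hG.continuousAt).const_add F₀
  have hKc : Continuous K := continuous_iff_continuousAt.mpr fun t => (hKd t).continuousAt
  have hK0 : K 0 = F₀ := by simp [hK]
  have key : ∀ η : ℝ → ℝ, ContDiff ℝ ∞ η → HasCompactSupport η → tsupport η ⊆ Ioi 0 →
      ∫ t, η t • (F t - K t) = 0 := by
    intro η hη hηc hη0
    have hηC : Continuous η := hη.continuous
    obtain ⟨b, hb⟩ : ∃ b, ∀ t, b ≤ t → η t = 0 := by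
      obtain ⟨b, hb⟩ := hηc.isCompact.bddAbove
      refine ⟨b + 1, fun t ht => image_eq_zero_of_notMem_tsupport fun hmem => ?_⟩
      have := hb hmem
      linarith
    have hI : ∀ t, HasDerivAt (fun t => ∫ s in b..t, η s) (η t) t := fun t =>
      intervalIntegral.integral_hasDerivAt_right (hηC.intervalIntegrable _ _)
        (hηC.stronglyMeasurableAtFilter _ _) hηC.continuousAt
    have hIc : ContDiff ℝ ∞ (fun t => ∫ s in b..t, η s) := by
      rw [contDiff_infty_iff_deriv]
      refine ⟨fun t => (hI t).differentiableAt, ?_⟩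
      rwa [show deriv (fun t => ∫ s in b..t, η s) = η from funext fun t => (hI t).deriv]
    -- a primitive of `η` on the half-line, cut off smoothly for negative times
    set θ : ℝ → ℝ := fun t => Real.smoothTransition (t + 1) * ∫ s in b..t, η s with hθ
    have hθc : ContDiff ℝ ∞ θ :=
      (Real.smoothTransition.contDiff.comp (contDiff_id.add contDiff_const)).mul hIc
    have hθb : ∀ t, b ≤ t → θ t = 0 := by
      intro t ht
      have : ∫ s in b..t, η s = 0 := by
        rw [intervalIntegral.integral_congr (g := fun _ => 0)]
        · simp
        · intro s hs
          rw [uIcc_of_le ht] at hs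
          exact hb s hs.1
      simp [hθ, this]
    have hθs : HasCompactSupport θ := by
      refine HasCompactSupport.intro (isCompact_Icc (a := (-1 : ℝ)) (b := b)) fun t ht => ?_
      rcases not_and_or.mp ht with h1 | h1
      · simp only [hθ]
        rw [Real.smoothTransition.zero_of_nonpos (by linarith [not_le.mp h1]), zero_mul]
      · exact hθb t (not_le.mp h1).le
    have hθd : ∀ t, 0 < t → deriv θ t = η t := by
      intro t ht
      have : θ =ᶠ[𝓝 t] fun t => ∫ s in b..t, η s := by
        filter_upwards [Ioi_mem_nhds ht] with s hs
        simp only [hθ]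
        rw [Real.smoothTransition.one_of_one_le (by linarith [mem_Ioi.mp hs]), one_mul]
      rw [this.deriv_eq, (hI t).deriv]
    have hθD : ∀ t, HasDerivAt θ (deriv θ t) t := fun t =>
      (hθc.differentiable (by simp) t).hasDerivAt
    have hθ'c : Continuous (deriv θ) := hθc.continuous_deriv (by simp)
    have hint : ∀ {A B : ℝ → ℝ}, Continuous A → Continuous B →
        Integrable fun t => deriv θ t * A t + θ t * B t := fun hA hB =>
      (Continuous.integrable_of_hasCompactSupport (hθ'c.mul hA) hθs.deriv.mul_right).add
        (Continuous.integrable_of_hasCompactSupport (hθc.continuous.mul hB) hθs.mul_right)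
    have hibp : ∫ t in Ioi (0 : ℝ), (deriv θ t * K t + θ t * G t) = 0 - θ 0 * K 0 := by
      refine integral_Ioi_of_hasDerivAt_of_tendsto (f := fun t => θ t * K t)
        (hθc.continuous.mul hKc).continuousWithinAt
        (fun t _ => (hθD t).mul (hKd t)) (hint hKc hG).integrableOn ?_
      refine tendsto_const_nhds.congr' ?_
      filter_upwards [eventually_ge_atTop b] with t ht
      rw [hθb t ht, zero_mul]
    have hw := h θ hθc hθs
    have hdiff : ∫ t in Ioi (0 : ℝ), η t • (F t - K t) = 0 := by
      have e : ∫ t in Ioi (0 : ℝ), η t • (F t - K t)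
          = ∫ t in Ioi (0 : ℝ), ((deriv θ t * F t + θ t * G t)
            - (deriv θ t * K t + θ t * G t)) := by
        refine setIntegral_congr_fun measurableSet_Ioi fun t ht => ?_
        simp only [smul_eq_mul, hθd t ht]; ring
      rw [e, integral_sub (hint hF hG).integrableOn (hint hKc hG).integrableOn, hibp, hK0]
      linarith
    rw [← hdiff, setIntegral_eq_integral_of_forall_compl_eq_zero]
    intro t ht
    rw [image_eq_zero_of_notMem_tsupport fun hm => ht (hη0 hm), zero_smul]
  have hae := isOpen_Ioi.ae_eq_zero_of_integral_contDiff_smul_eq_zero (μ := volume)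
    (f := fun t => F t - K t) ((hF.sub hKc).locallyIntegrable.locallyIntegrableOn _) key
  have hEq : EqOn (fun t => F t - K t) 0 (Ioi 0) :=
    Measure.eqOn_open_of_ae_eq (μ := volume) (by
      rw [Filter.EventuallyEq, ae_restrict_iff' measurableSet_Ioi]; exact hae) isOpen_Ioi
      (hF.sub hKc).continuousOn continuousOn_const
  have hcl := hEq.closure (hF.sub hKc) continuous_const
  rw [closure_Ioi] at hcl
  intro t ht
  exact sub_eq_zero.mp (hcl ht)

/-- Continuity in time with values in `L¹`, for functions defined for all real times. A function
on `[0,∞)` is extended to negative times by its value at zero, that is, composed with `max · 0`. -/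
def ContL1 (F : ℝ → Phase d → ℝ) : Prop := ∀ t, LpTendsto 1 (𝓝 t) F (F t)

lemma ContL1.integrable {F : ℝ → Phase d → ℝ} (h : ContL1 F) (t : ℝ) : Integrable (F t) :=
  (h t).integrable_lim

lemma tendsto_max_zero (t : ℝ) :
    Tendsto (fun s : ℝ => max s 0) (𝓝 t) (𝓝[Ici 0] (max t 0)) := by
  refine tendsto_nhdsWithin_iff.mpr ⟨?_, Eventually.of_forall fun s => le_max_right s 0⟩
  have : Continuous fun s : ℝ => max s 0 := by fun_prop
  exact this.tendsto t

lemma ContL1L2.contL1 {f : ℝ → Phase d → ℝ} (h : ContL1L2 f) : ContL1 fun t => f (max t 0) :=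
  fun t => ⟨fun _ => (h _ (le_max_right _ _)).1, (h _ (le_max_right _ _)).1,
    (h (max t 0) (le_max_right _ _)).2.2.1.comp (tendsto_max_zero t)⟩

lemma ContL1L2.lpTendsto_two {f : ℝ → Phase d → ℝ} (h : ContL1L2 f) (t : ℝ) :
    LpTendsto 2 (𝓝 t) (fun t => f (max t 0)) (f (max t 0)) :=
  ⟨fun _ => (h _ (le_max_right _ _)).2.1, (h _ (le_max_right _ _)).2.1,
    (h (max t 0) (le_max_right _ _)).2.2.2.comp (tendsto_max_zero t)⟩

lemma ContL1L2.contL1_flux {f : ℝ → Phase d → ℝ} (h : ContL1L2 f) (κ : ℝ) :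
    ContL1 fun t z => flux κ (f (max t 0) z) :=
  fun t => (h.contL1 t).flux κ (h.lpTendsto_two t)

lemma ContL1.continuous_integral_mul {F : ℝ → Phase d → ℝ} (h : ContL1 F) {ψ : Phase d → ℝ}
    (hψ : IsTest ψ) : Continuous fun t => ∫ z, F t z * ψ z := by
  obtain ⟨C, -, hC⟩ := hψ.exists_bound
  exact continuous_iff_continuousAt.mpr fun t =>
    (h t).tendsto_integral_mul hψ.continuous.aestronglyMeasurable hC

lemma ContL1.continuous_conv {F : ℝ → Phase d → ℝ} (h : ContL1 F) {τ : Phase d → ℝ}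
    (hτ : IsTest τ) : Continuous fun q : ℝ × Phase d => conv (F q.1) τ q.2 := by
  obtain ⟨C, -, hC⟩ := hτ.exists_bound
  refine continuous_iff_continuousAt.mpr fun q => ?_
  have t1 : Tendsto (fun r : ℝ × Phase d => C * ∫ z, |F r.1 z - F q.1 z|) (𝓝 q) (𝓝 0) := by
    have := ((h q.1).tendsto_integral_abs.const_mul C).comp
      (continuous_fst.tendsto q : Tendsto Prod.fst (𝓝 q) (𝓝 q.1))
    rwa [mul_zero] at this
  have t2 : Tendsto (fun r : ℝ × Phase d => |conv (F q.1) τ r.2 - conv (F q.1) τ q.2|) (𝓝 q)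
      (𝓝 0) := by
    have hc : Continuous fun r : ℝ × Phase d => |conv (F q.1) τ r.2 - conv (F q.1) τ q.2| :=
      (((QFP.continuous_conv (h.integrable q.1) hτ).comp continuous_snd).sub
        continuous_const).abs
    simpa using hc.tendsto q
  have t3 := t1.add t2
  rw [add_zero] at t3
  rw [ContinuousAt, tendsto_iff_dist_tendsto_zero]
  refine squeeze_zero (fun _ => dist_nonneg) (fun r => ?_) t3
  have e : conv (F r.1) τ r.2 - conv (F q.1) τ q.2 = conv (fun y => F r.1 y - F q.1 y) τ r.2
      + (conv (F q.1) τ r.2 - conv (F q.1) τ q.2) := by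
    rw [conv_sub (h.integrable _) (h.integrable _) hτ]; ring
  rw [Real.dist_eq, e]
  exact (abs_add_le _ _).trans (add_le_add
    (abs_conv_le ((h.integrable _).sub (h.integrable _)) hC _) le_rfl)

/-- The evolution of a mollified solution is jointly continuous in time and phase space. -/
lemma ContL1L2.continuous_evol {f : ℝ → Phase d → ℝ} (h : ContL1L2 f) (κ : ℝ) {ρ : Phase d → ℝ}
    (hρ : IsTest ρ) : Continuous fun q : ℝ × Phase d => evol κ (f (max q.1 0)) ρ q.2 := by
  have h1 := fun i => h.contL1.continuous_conv ((hρ.dirDeriv (Sum.inr i)).dirDeriv (Sum.inr i))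
  have h2 := fun k => (h.contL1_flux κ).continuous_conv (hρ.dirDeriv k)
  have h3 := fun k => (h.contL1_flux κ).continuous_conv
    ((hρ.dirDeriv k).mul_left (isSmooth_coord k))
  have h4 := fun k => (isSmooth_coord (d := d) k).continuous
  unfold evol
  fun_prop

/-- The operator `p · ∇_x - p · ∇_p`, which acts on the test functions in the weak equation. -/
noncomputable def drift (ψ : Phase d → ℝ) (z : Phase d) : ℝ :=
  ∑ k, -(orient k * (coord k z * dirDeriv k ψ z))

lemma IsTest.sum {ι : Type*} {s : Finset ι} {F : ι → Phase d → ℝ} (h : ∀ i ∈ s, IsTest (F i)) :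
    IsTest fun z => ∑ i ∈ s, F i z := by
  classical
  induction s using Finset.induction_on with
  | empty =>
    simp only [Finset.sum_empty]
    exact ⟨IsSmooth.const 0, HasCompactSupport.zero⟩
  | insert a s ha ih =>
    simp only [Finset.sum_insert ha]
    have h1 := h a (Finset.mem_insert_self a s)
    have h2 := ih fun i hi => h i (Finset.mem_insert_of_mem hi)
    exact ⟨h1.isSmooth.add h2.isSmooth, h1.2.add h2.2⟩

lemma isTest_drift {ψ : Phase d → ℝ} (h : IsTest ψ) : IsTest (drift ψ) := by
  refine IsTest.sum fun k _ => ?_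
  have := (((h.dirDeriv k).mul_left (isSmooth_coord k)).mul_left (IsSmooth.const (-orient k)))
  simpa only [neg_mul] using this

lemma isTest_laplacianP {ψ : Phase d → ℝ} (h : IsTest ψ) : IsTest (laplacianP ψ) := by
  refine IsTest.sum fun i _ => ?_
  rw [partialP_eq]
  exact (h.dirDeriv _).dirDeriv _

lemma isTimeTest_mul {θ : ℝ → ℝ} (hθ : ContDiff ℝ ∞ θ) (hθc : HasCompactSupport θ)
    {ψ : Phase d → ℝ} (hψ : IsTest ψ) : IsTimeTest fun t z => θ t * ψ z := by
  refine ⟨?_, HasCompactSupport.intro (hθc.isCompact.prod hψ.2.isCompact) fun q hq => ?_⟩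
  · exact (hθ.comp contDiff_fst).mul (ContDiff.comp (g := fun q => ψ (cover q)) hψ.isSmooth
      contDiff_snd)
  · rcases not_and_or.mp hq with h | h
    · simp [image_eq_zero_of_notMem_tsupport h]
    · simp [image_eq_zero_of_notMem_tsupport h]

lemma dirDeriv_const_mul {ψ : Phase d → ℝ} (hψ : IsTest ψ) (c : ℝ) (k : Fin d ⊕ Fin d) :
    dirDeriv k (fun z => c * ψ z) = fun z => c * dirDeriv k ψ z :=
  ((hψ.hasDir k).const_mul c).dirDeriv_eq

/-- A weak solution satisfies the time-integrated equation, tested against functions on phase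
space. -/
lemma IsWeakSolution.integral_mul_eq {κ : ℝ} {f₀ : Phase d → ℝ} {f : ℝ → Phase d → ℝ}
    (hf : IsWeakSolution κ f₀ f) {ψ : Phase d → ℝ} (hψ : IsTest ψ) {t : ℝ} (ht : 0 ≤ t) :
    ∫ z, f t z * ψ z = (∫ z, ψ z * f₀ z) + ∫ s in (0 : ℝ)..t,
      ((∫ z, f (max s 0) z * laplacianP ψ z) + ∫ z, flux κ (f (max s 0) z) * drift ψ z) := by
  obtain ⟨hc, -, hw⟩ := hf
  have hL := isTest_laplacianP hψ
  have hD := isTest_drift hψ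
  have c1 := hc.contL1.continuous_integral_mul hψ
  have c2 : Continuous fun s => (∫ z, f (max s 0) z * laplacianP ψ z)
      + ∫ z, flux κ (f (max s 0) z) * drift ψ z :=
    (hc.contL1.continuous_integral_mul hL).add ((hc.contL1_flux κ).continuous_integral_mul hD)
  have := eq_add_integral_of_weak (F₀ := ∫ z, ψ z * f₀ z) c1 c2 (fun θ hθ hθc => ?_) t ht
  · simpa only [max_eq_left ht] using this
  · refine Eq.trans ?_ (hw _ (isTimeTest_mul hθ hθc hψ))
    congr 1
    · refine setIntegral_congr_fun measurableSet_Ioi fun s hs => ?_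
      have hs0 : max s 0 = s := max_eq_left (le_of_lt hs)
      have m : ∀ {u φ : Phase d → ℝ}, Integrable u → IsTest φ → Integrable fun z => u z * φ z :=
        fun hu hφ => by
          obtain ⟨C, -, hC⟩ := hφ.exists_bound
          exact hu.mul_bdd (c := C) hφ.continuous.aestronglyMeasurable (Eventually.of_forall hC)
      have i1 := m (hc.contL1.integrable s) hψ
      have i2 := m (hc.contL1.integrable s) hL
      have i3 := m ((hc.contL1_flux κ).integrable s) hD
      simp only [hs0] at i1 i2 i3 ⊢
      rw [← integral_add i2 i3, ← integral_const_mul, ← integral_const_mul]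
      refine (integral_add (i1.const_mul _) ((i2.add i3).const_mul _)).symm.trans ?_
      refine integral_congr_ae (Eventually.of_forall fun z => ?_)
      have e1 : deriv (fun s => θ s * ψ z) s = deriv θ s * ψ z :=
        deriv_mul_const (hθ.differentiable (by simp) s) _
      have e2 : laplacianP (fun z => θ s * ψ z) z = θ s * laplacianP ψ z := by
        simp only [laplacianP, partialP_eq, Finset.mul_sum]
        refine Finset.sum_congr rfl fun i _ => ?_
        rw [dirDeriv_const_mul hψ, dirDeriv_const_mul (hψ.dirDeriv _)]
      have e3 : drift ψ z = ∑ i, z.2 i * dirDeriv (Sum.inl i) ψ z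
          - ∑ i, z.2 i * dirDeriv (Sum.inr i) ψ z := by
        rw [drift, Fintype.sum_sum_type, sub_eq_add_neg, ← Finset.sum_neg_distrib]
        simp [orient, coord]
      simp only [e1, e2, e3, partialX_eq, partialP_eq, dirDeriv_const_mul hψ, flux,
        mul_left_comm _ (θ s), ← Finset.mul_sum, Pi.add_apply]
      ring
    · rw [← integral_const_mul]
      simp only [mul_assoc]

lemma laplacianP_const_sub {ρ : Phase d → ℝ} (hρ : IsTest ρ) (z y : Phase d) :
    laplacianP (fun y => ρ (z - y)) y
      = ∑ i, dirDeriv (Sum.inr i) (dirDeriv (Sum.inr i) ρ) (z - y) := by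
  simp only [laplacianP, partialP_eq]
  refine Finset.sum_congr rfl fun i _ => ?_
  rw [((hρ.hasDir (Sum.inr i)).const_sub z).dirDeriv_eq]
  have := ((((hρ.dirDeriv (Sum.inr i)).hasDir (Sum.inr i)).const_sub z).const_mul (-1)).dirDeriv_eq
  simp only [neg_mul, one_mul, neg_neg] at this
  rw [this]

lemma coord_sub (k : Fin d ⊕ Fin d) (z y : Phase d) : coord k (z - y) = coord k z - coord k y := by
  simp [coord]

/-- The mollified solution satisfies the mollified equation pointwise. -/
lemma IsWeakSolution.conv_eq {κ : ℝ} {f₀ : Phase d → ℝ} {f : ℝ → Phase d → ℝ}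
    (hf : IsWeakSolution κ f₀ f) {ρ : Phase d → ℝ} (hρ : IsTest ρ) (z : Phase d) {t : ℝ}
    (ht : 0 ≤ t) :
    conv (f t) ρ z = conv (f 0) ρ z + ∫ s in (0 : ℝ)..t, evol κ (f (max s 0)) ρ z := by
  have h0 := hf.integral_mul_eq (hρ.const_sub z) le_rfl
  have h1 := hf.integral_mul_eq (hρ.const_sub z) ht
  rw [intervalIntegral.integral_same, add_zero] at h0
  rw [← h0] at h1
  have e : ∀ s, ((∫ y, f (max s 0) y * laplacianP (fun y => ρ (z - y)) y)
      + ∫ y, flux κ (f (max s 0) y) * drift (fun y => ρ (z - y)) y)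
        = evol κ (f (max s 0)) ρ z := by
    intro s
    have hi := hf.1.contL1.integrable s
    have hK := (hf.1.contL1_flux κ).integrable s
    rw [evol]
    congr 1
    · simp only [laplacianP_const_sub hρ, Finset.mul_sum]
      rw [integral_finsetSum _ fun i _ =>
        integrable_conv_integrand hi ((hρ.dirDeriv _).dirDeriv _) z]
      rfl
    · have e1 : ∀ y, flux κ (f (max s 0) y) * drift (fun y => ρ (z - y)) y
          = ∑ k, (orient k * coord k z * (flux κ (f (max s 0) y) * dirDeriv k ρ (z - y))
            - orient k * (flux κ (f (max s 0) y)
              * (coord k (z - y) * dirDeriv k ρ (z - y)))) := by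
        intro y
        rw [drift, Finset.mul_sum]
        refine Finset.sum_congr rfl fun k _ => ?_
        rw [((hρ.hasDir k).const_sub z).dirDeriv_eq, coord_sub]
        ring
      have j1 := fun k => (integrable_conv_integrand hK (hρ.dirDeriv k) z).const_mul
        (orient k * coord k z)
      have j2 := fun k => (integrable_conv_integrand hK
        ((hρ.dirDeriv k).mul_left (isSmooth_coord k)) z).const_mul (orient k)
      simp only [e1]
      refine (integral_finsetSum _ fun k _ => (j1 k).sub (j2 k)).trans ?_
      refine Finset.sum_congr rfl fun k _ => ?_
      refine (integral_sub (j1 k) (j2 k)).trans ?_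
      rw [integral_const_mul, integral_const_mul, conv, conv]
      ring
  simp only [e] at h1
  exact h1

lemma tendsto_logCutoff (z : Phase d) : ∀ᶠ n : ℕ in atTop, logCutoff (n + 1 : ℝ) z = 1 := by
  obtain ⟨N, hN⟩ := exists_nat_ge (logWeight z)
  filter_upwards [eventually_ge_atTop N] with n hn
  refine logCutoff_eq_one (by positivity) ?_
  have : (N : ℝ) ≤ n := by exact_mod_cast hn
  linarith

/-- A locally integrable function that vanishes as a distribution vanishes almost everywhere. -/
lemma ae_eq_zero_of_integral_test_eq_zero {h : Phase d → ℝ} (hl : LocallyIntegrable h volume)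
    (h0 : ∀ ψ, IsTest ψ → ∫ z, h z * ψ z = 0) : ∀ᵐ z, h z = 0 := by
  have key : ∀ n : ℕ, ∀ᵐ z, h z * logCutoff (n + 1 : ℝ) z = 0 := by
    intro n
    have hχ := isTest_logCutoff (d := d) (R := n + 1) (by positivity)
    have hi : Integrable fun z => h z * logCutoff (n + 1 : ℝ) z := by
      have := hl.integrable_smul_left_of_hasCompactSupport hχ.continuous hχ.2
      refine this.congr (Eventually.of_forall fun z => ?_)
      simp [mul_comm]
    have hρ := isApproxUnit_approxUnit (d := d)
    have hc : ∀ m, conv (fun z => h z * logCutoff (n + 1 : ℝ) z) (approxUnit m) = 0 := by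
      intro m
      funext z
      have := h0 _ (((hρ.isMollifier m).isTest.const_sub z).mul_left hχ.isSmooth)
      rw [Pi.zero_apply, ← this, conv]
      simp only [mul_assoc]
    have ht := (hρ.lpTendsto_one hi).tendsto
    simp only [hc, Pi.zero_apply, zero_sub] at ht
    have hz := tendsto_nhds_unique ht tendsto_const_nhds
    have hn : eLpNorm (fun z => h z * logCutoff (n + 1 : ℝ) z) 1 volume = 0 := by
      rw [← eLpNorm_neg]; exact hz.symm
    exact (eLpNorm_eq_zero_iff hi.1 one_ne_zero).mp hn
  filter_upwards [ae_all_iff.mpr key] with z hz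
  obtain ⟨n, hn⟩ := (tendsto_logCutoff z).exists
  simpa [hn] using hz n

lemma IsWeakSolution.initial_ae_eq {κ : ℝ} {f₀ : Phase d → ℝ} {f : ℝ → Phase d → ℝ}
    (hf : IsWeakSolution κ f₀ f) : f 0 =ᵐ[volume] f₀ := by
  have hi : Integrable (f 0) := memLp_one_iff_integrable.mp (hf.1 0 le_rfl).1
  have hl := hi.locallyIntegrable.sub hf.2.1
  have := ae_eq_zero_of_integral_test_eq_zero hl fun ψ hψ => ?_
  · filter_upwards [this] with z hz
    exact sub_eq_zero.mp hz
  · have h0 := hf.integral_mul_eq hψ le_rfl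
    rw [intervalIntegral.integral_same, add_zero] at h0
    have i1 : Integrable fun z => f 0 z * ψ z := by
      obtain ⟨C, -, hC⟩ := hψ.exists_bound
      exact hi.mul_bdd (c := C) hψ.continuous.aestronglyMeasurable (Eventually.of_forall hC)
    have i2 : Integrable fun z => f₀ z * ψ z := by
      have := hf.2.1.integrable_smul_left_of_hasCompactSupport hψ.continuous hψ.2
      refine this.congr (Eventually.of_forall fun z => ?_)
      simp [mul_comm]
    simp only [Pi.sub_apply, sub_mul]
    rw [integral_sub i1 i2, h0, sub_eq_zero]
    exact integral_congr_ae (Eventually.of_forall fun z => mul_comm _ _)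

/-! ### The contraction estimate with a cutoff -/

section Energy

variable {κ ε T : ℝ} {f₀ g₀ : Phase d → ℝ} {f g : ℝ → Phase d → ℝ} {ρ χ : Phase d → ℝ}

/-- The density in time and phase space of the dissipation of `softAbs ε (f - g)`. -/
noncomputable def dissip (κ ε : ℝ) (f g : ℝ → Phase d → ℝ) (ρ χ : Phase d → ℝ)
    (q : ℝ × Phase d) : ℝ :=
  softSign ε (conv (f (max q.1 0)) ρ q.2 - conv (g (max q.1 0)) ρ q.2) * χ q.2
    * (evol κ (f (max q.1 0)) ρ q.2 - evol κ (g (max q.1 0)) ρ q.2)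

lemma continuous_dissip (hf : ContL1L2 f) (hg : ContL1L2 g) (hρ : IsTest ρ) (hχ : IsTest χ)
    (hε : 0 < ε) : Continuous (dissip κ ε f g ρ χ) := by
  have c1 := hf.contL1.continuous_conv hρ
  have c2 := hg.contL1.continuous_conv hρ
  have c3 := hf.continuous_evol κ hρ
  have c4 := hg.continuous_evol κ hρ
  have c5 := continuous_softSign hε
  have c6 := hχ.continuous
  unfold dissip
  fun_prop

lemma integrable_dissip (hf : ContL1L2 f) (hg : ContL1L2 g) (hρ : IsTest ρ) (hχ : IsTest χ)
    (hε : 0 < ε) (T : ℝ) :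
    Integrable (dissip κ ε f g ρ χ) ((volume.restrict (Ioc (0 : ℝ) T)).prod volume) := by
  have hK : IsCompact (Icc (0 : ℝ) T ×ˢ tsupport χ) := isCompact_Icc.prod hχ.2.isCompact
  have h1 : IntegrableOn (dissip κ ε f g ρ χ) (Icc (0 : ℝ) T ×ˢ tsupport χ)
      ((volume : Measure ℝ).prod (volume : Measure (Phase d))) :=
    (continuous_dissip hf hg hρ hχ hε).continuousOn.integrableOn_compact hK
  have h2 : (volume.restrict (Ioc (0 : ℝ) T)).prod (volume : Measure (Phase d))
      = ((volume : Measure ℝ).prod (volume : Measure (Phase d))).restrict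
        (Ioc (0 : ℝ) T ×ˢ univ) := by
    rw [← Measure.prod_restrict, Measure.restrict_univ]
  rw [h2]
  refine IntegrableOn.of_forall_sdiff_eq_zero h1 (measurableSet_Ioc.prod MeasurableSet.univ)
    fun q hq => ?_
  have : q.2 ∉ tsupport χ := fun h => hq.2 ⟨Ioc_subset_Icc_self hq.1.1, h⟩
  simp [dissip, image_eq_zero_of_notMem_tsupport this]

/-- The balance law for the regularized `L¹` distance of two mollified solutions. -/
lemma integral_softAbs_eq (hf : IsWeakSolution κ f₀ f) (hg : IsWeakSolution κ g₀ g)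
    (hρ : IsTest ρ) (hχ : IsTest χ) (hε : 0 < ε) (hT : 0 ≤ T) :
    ∫ z, softAbs ε (conv (f T) ρ z - conv (g T) ρ z) * χ z
      = (∫ z, softAbs ε (conv (f 0) ρ z - conv (g 0) ρ z) * χ z)
        + ∫ s in Ioc 0 T, ∫ z, dissip κ ε f g ρ χ (s, z) := by
  have hpt : ∀ z, softAbs ε (conv (f T) ρ z - conv (g T) ρ z) * χ z
      - softAbs ε (conv (f 0) ρ z - conv (g 0) ρ z) * χ z
        = ∫ s in Ioc 0 T, dissip κ ε f g ρ χ (s, z) := by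
    intro z
    have c1 : Continuous fun s => conv (f (max s 0)) ρ z :=
      (hf.1.contL1.continuous_conv hρ).comp (by fun_prop : Continuous fun s : ℝ => (s, z))
    have c2 : Continuous fun s => conv (g (max s 0)) ρ z :=
      (hg.1.contL1.continuous_conv hρ).comp (by fun_prop : Continuous fun s : ℝ => (s, z))
    have c3 : Continuous fun s => evol κ (f (max s 0)) ρ z :=
      (hf.1.continuous_evol κ hρ).comp (by fun_prop : Continuous fun s : ℝ => (s, z))
    have c4 : Continuous fun s => evol κ (g (max s 0)) ρ z :=
      (hg.1.continuous_evol κ hρ).comp (by fun_prop : Continuous fun s : ℝ => (s, z))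
    have c5 : Continuous fun s => dissip κ ε f g ρ χ (s, z) :=
      (continuous_dissip hf.1 hg.1 hρ hχ hε).comp (by fun_prop : Continuous fun s : ℝ => (s, z))
    have hder : ∀ {h₀ : Phase d → ℝ} {h : ℝ → Phase d → ℝ}, IsWeakSolution κ h₀ h →
        (Continuous fun s => evol κ (h (max s 0)) ρ z) → ∀ s, 0 < s →
        HasDerivAt (fun s => conv (h (max s 0)) ρ z) (evol κ (h (max s 0)) ρ z) s := by
      intro h₀ h hh hc s hs
      have h1 := (intervalIntegral.integral_hasDerivAt_right (hc.intervalIntegrable 0 s)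
        (hc.stronglyMeasurableAtFilter _ _) hc.continuousAt).const_add (conv (h 0) ρ z)
      refine h1.congr_of_eventuallyEq ?_
      filter_upwards [Ioi_mem_nhds hs] with r hr
      rw [max_eq_left (le_of_lt hr), hh.conv_eq hρ z (le_of_lt hr)]
    have hd : ∀ s ∈ Ioo 0 T, HasDerivAt
        (fun s => softAbs ε (conv (f (max s 0)) ρ z - conv (g (max s 0)) ρ z) * χ z)
        (dissip κ ε f g ρ χ (s, z)) s := by
      intro s hs
      have h1 := (hder hf c3 s hs.1).sub (hder hg c4 s hs.1)
      have h2 := ((hasDerivAt_softAbs hε _).comp s h1).mul_const (χ z)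
      refine h2.congr_deriv ?_
      simp only [dissip, Pi.sub_apply]; ring
    have ca := continuous_softAbs ε
    have := intervalIntegral.integral_eq_sub_of_hasDerivAt_of_le hT
      (by fun_prop : Continuous fun s => softAbs ε (conv (f (max s 0)) ρ z
        - conv (g (max s 0)) ρ z) * χ z).continuousOn hd (c5.intervalIntegrable _ _)
    rw [intervalIntegral.integral_of_le hT] at this
    rw [this, max_eq_left hT, max_self]
  have hint : ∀ t, 0 ≤ t →
      Integrable fun z => softAbs ε (conv (f t) ρ z - conv (g t) ρ z) * χ z := by
    intro t ht
    have i1 := memLp_one_iff_integrable.mp (hf.1 t ht).1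
    have i2 := memLp_one_iff_integrable.mp (hg.1 t ht).1
    have c1 := continuous_conv i1 hρ
    have c2 := continuous_conv i2 hρ
    have c3 := continuous_softAbs ε
    have c4 := hχ.continuous
    exact Continuous.integrable_of_hasCompactSupport (by fun_prop) hχ.2.mul_left
  rw [integral_integral_swap (f := fun s z => dissip κ ε f g ρ χ (s, z))
    (integrable_dissip hf.1 hg.1 hρ hχ hε T)]
  simp only [← hpt]
  rw [integral_sub (hint T hT) (hint 0 le_rfl)]
  ring

end Energy

lemma ofReal_integral_le_lintegral {α : Type*} [MeasurableSpace α] {μ : Measure α} {F : α → ℝ}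
    (hF : Integrable F μ) : ENNReal.ofReal (∫ x, F x ∂μ) ≤ ∫⁻ x, ENNReal.ofReal (F x) ∂μ := by
  rw [integral_eq_lintegral_pos_part_sub_lintegral_neg_part hF]
  refine le_trans (ENNReal.ofReal_le_ofReal (sub_le_self _ ENNReal.toReal_nonneg)) ?_
  exact ENNReal.ofReal_toReal_le

section Comparison

variable {f g χ ρ : Phase d → ℝ} {η ε : ℝ}

lemma integral_abs_mul_cutoff_le (hf : Integrable f) (hg : Integrable g) (hχ : IsCutoff η χ)
    (hρ : IsMollifier ρ) (ε : ℝ) :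
    ∫ z, |f z - g z| * χ z ≤ (∫ z, softAbs ε (conv f ρ z - conv g ρ z) * χ z)
      + ((∫ z, |conv f ρ z - f z|) + ∫ z, |conv g ρ z - g z|) := by
  have c1 := continuous_conv hf hρ.isTest
  have c2 := continuous_conv hg hρ.isTest
  have c3 := continuous_softAbs ε
  have c4 := hχ.isTest.continuous
  have i1 : Integrable fun z => softAbs ε (conv f ρ z - conv g ρ z) * χ z :=
    Continuous.integrable_of_hasCompactSupport (by fun_prop) hχ.isTest.2.mul_left
  have i2 : Integrable fun z => |conv f ρ z - f z| :=
    ((integrable_conv hf hρ.isTest).sub hf).abs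
  have i3 : Integrable fun z => |conv g ρ z - g z| :=
    ((integrable_conv hg hρ.isTest).sub hg).abs
  have i23 : Integrable fun z => |conv f ρ z - f z| + |conv g ρ z - g z| := i2.add i3
  rw [← integral_add i2 i3, ← integral_add i1 i23]
  refine integral_mono_of_nonneg
    (Eventually.of_forall fun z => mul_nonneg (abs_nonneg _) (hχ.nonneg z))
    (i1.add i23) (Eventually.of_forall fun z => ?_)
  have h1 := abs_le_softAbs ε (conv f ρ z - conv g ρ z)
  have h2 : |f z - g z| ≤ |conv f ρ z - conv g ρ z|
      + (|conv f ρ z - f z| + |conv g ρ z - g z|) := by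
    have e : f z - g z = (conv f ρ z - conv g ρ z)
      + (-(conv f ρ z - f z) + (conv g ρ z - g z)) := by ring
    rw [e]
    refine (abs_add_le _ _).trans (add_le_add le_rfl ((abs_add_le _ _).trans ?_))
    rw [abs_neg]
  have h3 : |f z - g z| * χ z ≤ (softAbs ε (conv f ρ z - conv g ρ z)
      + (|conv f ρ z - f z| + |conv g ρ z - g z|)) * χ z :=
    mul_le_mul_of_nonneg_right (by linarith) (hχ.nonneg z)
  refine h3.trans ?_
  rw [add_mul]
  exact add_le_add le_rfl (mul_le_of_le_one_right (by positivity) (hχ.le_one z))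

lemma integral_softAbs_mul_cutoff_le (hf : Integrable f) (hg : Integrable g)
    (hχ : IsCutoff η χ) (hρ : IsMollifier ρ) (hε : 0 < ε) :
    ∫ z, softAbs ε (conv f ρ z - conv g ρ z) * χ z ≤ (∫ z, |f z - g z|)
      + ((∫ z, |conv f ρ z - f z|) + (∫ z, |conv g ρ z - g z|) + ε * ∫ z, χ z) := by
  have i0 : Integrable fun z => |f z - g z| := (hf.sub hg).abs
  have i2 : Integrable fun z => |conv f ρ z - f z| :=
    ((integrable_conv hf hρ.isTest).sub hf).abs
  have i3 : Integrable fun z => |conv g ρ z - g z| :=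
    ((integrable_conv hg hρ.isTest).sub hg).abs
  have i4 := hχ.isTest.integrable.const_mul ε
  have i23 : Integrable fun z => |conv f ρ z - f z| + |conv g ρ z - g z| := i2.add i3
  have i234 : Integrable fun z => |conv f ρ z - f z| + |conv g ρ z - g z| + ε * χ z := i23.add i4
  rw [← integral_const_mul, ← integral_add i2 i3, ← integral_add i23 i4,
    ← integral_add i0 i234]
  refine integral_mono_of_nonneg
    (Eventually.of_forall fun z => mul_nonneg (Real.sqrt_nonneg _) (hχ.nonneg z))
    (i0.add i234) (Eventually.of_forall fun z => ?_)
  have h1 := softAbs_le hε (conv f ρ z - conv g ρ z)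
  have h2 : |conv f ρ z - conv g ρ z| ≤ |f z - g z|
      + (|conv f ρ z - f z| + |conv g ρ z - g z|) := by
    have e : conv f ρ z - conv g ρ z = (f z - g z)
      + ((conv f ρ z - f z) + -(conv g ρ z - g z)) := by ring
    rw [e]
    refine (abs_add_le _ _).trans (add_le_add le_rfl ((abs_add_le _ _).trans ?_))
    rw [abs_neg]
  have h3 : softAbs ε (conv f ρ z - conv g ρ z) * χ z ≤ (|f z - g z|
      + (|conv f ρ z - f z| + |conv g ρ z - g z|) + ε) * χ z :=
    mul_le_mul_of_nonneg_right (by linarith) (hχ.nonneg z)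
  refine h3.trans ?_
  have h4 : (|f z - g z| + (|conv f ρ z - f z| + |conv g ρ z - g z|)) * χ z
      ≤ |f z - g z| + (|conv f ρ z - f z| + |conv g ρ z - g z|) :=
    mul_le_of_le_one_right (by positivity) (hχ.le_one z)
  rw [add_mul]
  dsimp only [Pi.add_apply]
  linarith

end Comparison

/-- The contraction estimate with a cutoff. The error is linear in the cutoff parameter `η`, with
a constant that does not depend on the cutoff. -/
lemma ofReal_integral_cutoff_le {κ η C T : ℝ} {f₀ g₀ : Phase d → ℝ} {f g : ℝ → Phase d → ℝ}
    {χ : Phase d → ℝ} {S : ℝ → ENNReal} (hκ : |κ| ≤ 1) (hf : IsWeakSolution κ f₀ f)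
    (hg : IsWeakSolution κ g₀ g) (hT : 0 ≤ T) (hχ : IsCutoff η χ) (hC : CutoffBound C χ)
    (hη : 0 ≤ η) (hηC : η ≤ C) (hS : AEMeasurable S (volume.restrict (Ioc 0 T)))
    (hS2 : ∫⁻ s in Ioc 0 T, S s ^ 2 ≠ ⊤)
    (hreg : ∀ᵐ s ∂(volume.restrict (Ioc 0 T)), ∃ u v, IsRegular (f s) u ∧ IsRegular (g s) v ∧
      BoundedBy (S s).toReal (f s) u ∧ BoundedBy (S s).toReal (g s) v) :
    ENNReal.ofReal (∫ z, |f T z - g T z| * χ z)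
      ≤ ENNReal.ofReal (∫ z, |f 0 z - g 0 z|)
        + ENNReal.ofReal (14 * d * η) * ∫⁻ s in Ioc 0 T, S s ^ 2 := by
  have hρ := isApproxUnit_approxUnit (d := d)
  set ρ := approxUnit (d := d)
  set ε : ℕ → ℝ := fun n => 1 / ((n : ℝ) + 1) with hεdef
  have hε : ∀ n, 0 < ε n := fun n => by positivity
  have hε1 : ∀ n, ε n ≤ 1 := fun n => by
    rw [hεdef]; simp only
    rw [div_le_one (by positivity)]
    linarith [(n.cast_nonneg : (0 : ℝ) ≤ n)]
  have hεt : Tendsto ε atTop (𝓝 0) := tendsto_one_div_add_atTop_nhds_zero_nat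
  have hC0 := hC.nonneg
  obtain ⟨M, hM0, hM⟩ : ∃ M : ℝ, 0 ≤ M ∧ ∀ k n, ∫ z, |coord k z * ρ n z| ≤ M := by
    have h1 : ∀ k, ∃ M, ∀ n, ∫ z, |coord k z * ρ n z| ≤ M := fun k => by
      obtain ⟨M, hM⟩ := (hρ.tendsto_integral_coord k).bddAbove_range
      exact ⟨M, fun n => hM ⟨n, rfl⟩⟩
    choose M hM using h1
    refine ⟨∑ k, |M k|, Finset.sum_nonneg fun k _ => abs_nonneg _, fun k n => ?_⟩
    exact (hM k n).trans ((le_abs_self _).trans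
      (Finset.single_le_sum (fun k _ => abs_nonneg (M k)) (Finset.mem_univ k)))
  set I : ℕ → ℝ → ℝ := fun n s => ∫ z, dissip κ (ε n) f g (ρ n) χ (s, z) with hI
  have hIint : ∀ n, IntegrableOn (I n) (Ioc 0 T) := fun n =>
    (integrable_dissip hf.1 hg.1 (hρ.isMollifier n).isTest hχ.isTest (hε n) T).integral_prod_left
  set J : ℕ → ℝ → ENNReal := fun n s =>
    ENNReal.ofReal (I n s - 14 * d * η * (S s).toReal ^ 2) with hJ
  set B : ℝ := d * (16 * (C + 1)) + 4 * d * (6 * C + 3 * M + 4) with hB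
  have hB0 : 0 ≤ B := by positivity
  -- the excess of the dissipation over its limit bound vanishes, by dominated convergence
  have hJ0 : Tendsto (fun n => ∫⁻ s in Ioc 0 T, J n s) atTop (𝓝 0) := by
    have hkey : ∀ᵐ s ∂(volume.restrict (Ioc 0 T)), ∃ Q : ℕ → ℝ, Tendsto Q atTop (𝓝 0) ∧
        (∀ n, Q n ≤ 4 * d * (6 * C + 3 * M + 4) * (S s).toReal ^ 2) ∧
        ∀ n, I n s - 14 * d * η * (S s).toReal ^ 2
          ≤ ε n * (d * (16 * (C + 1)) * (S s).toReal ^ 2) + Q n := by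
      filter_upwards [hreg, ae_restrict_mem measurableSet_Ioc] with s ⟨u, v, hu, hv, hSu, hSv⟩ hs
      refine ⟨fun n => ∑ k, commBound κ C (f s) (u k) (ρ n) k
        + ∑ k, commBound κ C (g s) (v k) (ρ n) k, ?_, fun n => ?_, fun n => ?_⟩
      · have t1 := tendsto_finsetSum Finset.univ fun k _ => tendsto_commBound hρ hu κ C k
        have t2 := tendsto_finsetSum Finset.univ fun k _ => tendsto_commBound hρ hv κ C k
        simpa using t1.add t2
      · have s1 := Finset.sum_le_card_nsmul Finset.univ _ _ fun k _ =>
          commBound_le hκ hC0 hSu hu (hρ.isMollifier n) (hM k n)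
        have s2 := Finset.sum_le_card_nsmul Finset.univ _ _ fun k _ =>
          commBound_le hκ hC0 hSv hv (hρ.isMollifier n) (hM k n)
        simp only [Finset.card_univ, Fintype.card_sum, Fintype.card_fin, nsmul_eq_mul] at s1 s2
        push_cast at s1 s2
        linarith
      · have h1 := integral_evol_le hκ hχ hC hη hηC (hε n) (hρ.isMollifier n) hu hv hSu hSv
        simp only [hI, dissip, max_eq_left hs.1.le]
        linarith
    have hbound : ∀ n, ∀ᵐ s ∂(volume.restrict (Ioc 0 T)),
        J n s ≤ ENNReal.ofReal B * S s ^ 2 := by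
      intro n
      filter_upwards [hkey] with s ⟨Q, _, hQ, hle⟩
      calc J n s ≤ ENNReal.ofReal (B * (S s).toReal ^ 2) := by
            refine ENNReal.ofReal_le_ofReal ((hle n).trans ?_)
            have h0 : 0 ≤ d * (16 * (C + 1)) * (S s).toReal ^ 2 := by positivity
            have h1 := mul_le_of_le_one_left h0 (hε1 n)
            rw [hB, add_mul]
            exact add_le_add h1 (hQ n)
        _ = ENNReal.ofReal B * ENNReal.ofReal (S s).toReal ^ 2 := by
            rw [ENNReal.ofReal_mul hB0, ENNReal.ofReal_pow ENNReal.toReal_nonneg]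
        _ ≤ ENNReal.ofReal B * S s ^ 2 := by gcongr; exact ENNReal.ofReal_toReal_le
    have hlim : ∀ᵐ s ∂(volume.restrict (Ioc 0 T)), Tendsto (fun n => J n s) atTop (𝓝 0) := by
      filter_upwards [hkey] with s ⟨Q, hQ, _, hle⟩
      have h1 := (hεt.mul_const (d * (16 * (C + 1)) * (S s).toReal ^ 2)).add hQ
      rw [zero_mul, add_zero] at h1
      have h2 := ENNReal.tendsto_ofReal h1
      rw [ENNReal.ofReal_zero] at h2
      exact tendsto_of_tendsto_of_tendsto_of_le_of_le tendsto_const_nhds h2 (fun _ => zero_le)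
        fun n => ENNReal.ofReal_le_ofReal (hle n)
    have := tendsto_lintegral_of_dominated_convergence' (fun s => ENNReal.ofReal B * S s ^ 2)
      (fun n => ?_) hbound ?_ hlim
    · simpa using this
    · exact ((hIint n).aemeasurable.sub
        ((hS.ennreal_toReal.pow_const 2).const_mul _)).ennreal_ofReal
    · rw [lintegral_const_mul'' _ (hS.pow_const 2)]
      exact ENNReal.mul_ne_top ENNReal.ofReal_ne_top hS2
  have hIle : ∀ n, ENNReal.ofReal (∫ s in Ioc 0 T, I n s) ≤ (∫⁻ s in Ioc 0 T, J n s)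
      + ENNReal.ofReal (14 * d * η) * ∫⁻ s in Ioc 0 T, S s ^ 2 := by
    intro n
    have hA : 0 ≤ 14 * d * η := by positivity
    rw [← lintegral_const_mul'' _ (hS.pow_const 2), ← lintegral_add_right' _
      ((hS.pow_const 2).const_mul _)]
    refine le_trans (ofReal_integral_le_lintegral (hIint n)) (lintegral_mono fun s => ?_)
    calc ENNReal.ofReal (I n s)
        ≤ J n s + ENNReal.ofReal (14 * d * η * (S s).toReal ^ 2) := by
          rw [hJ]
          refine le_trans (ENNReal.ofReal_le_ofReal ?_) ENNReal.ofReal_add_le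
          linarith
      _ = J n s + ENNReal.ofReal (14 * d * η) * ENNReal.ofReal (S s).toReal ^ 2 := by
          rw [ENNReal.ofReal_mul hA, ENNReal.ofReal_pow ENNReal.toReal_nonneg]
      _ ≤ J n s + ENNReal.ofReal (14 * d * η) * S s ^ 2 := by
          gcongr; exact ENNReal.ofReal_toReal_le
  have hi : ∀ t, 0 ≤ t → Integrable (f t) ∧ Integrable (g t) := fun t ht =>
    ⟨memLp_one_iff_integrable.mp (hf.1 t ht).1, memLp_one_iff_integrable.mp (hg.1 t ht).1⟩
  -- the mollification errors at the initial and at the final time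
  set r : ℕ → ℝ := fun n =>
    ((∫ z, |conv (f T) (ρ n) z - f T z|) + ∫ z, |conv (g T) (ρ n) z - g T z|)
    + ((∫ z, |conv (f 0) (ρ n) z - f 0 z|) + (∫ z, |conv (g 0) (ρ n) z - g 0 z|)
      + ε n * ∫ z, χ z) with hr
  have hr0 : Tendsto r atTop (𝓝 0) := by
    have t1 := (hρ.lpTendsto_one (hi T hT).1).tendsto_integral_abs
    have t2 := (hρ.lpTendsto_one (hi T hT).2).tendsto_integral_abs
    have t3 := (hρ.lpTendsto_one (hi 0 le_rfl).1).tendsto_integral_abs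
    have t4 := (hρ.lpTendsto_one (hi 0 le_rfl).2).tendsto_integral_abs
    have := (t1.add t2).add ((t3.add t4).add (hεt.mul_const (∫ z, χ z)))
    simpa only [zero_mul, add_zero] using this
  have hfin : ∀ n, ENNReal.ofReal (∫ z, |f T z - g T z| * χ z)
      ≤ ENNReal.ofReal (∫ z, |f 0 z - g 0 z|) + ENNReal.ofReal (r n)
        + ((∫⁻ s in Ioc 0 T, J n s)
          + ENNReal.ofReal (14 * d * η) * ∫⁻ s in Ioc 0 T, S s ^ 2) := by
    intro n
    have hm := hρ.isMollifier n
    have h1 := integral_abs_mul_cutoff_le (hi T hT).1 (hi T hT).2 hχ hm (ε n)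
    have h2 := integral_softAbs_mul_cutoff_le (hi 0 le_rfl).1 (hi 0 le_rfl).2 hχ hm (hε n)
    have h3 := integral_softAbs_eq hf hg hm.isTest hχ.isTest (hε n) hT
    have h4 : ∫ z, |f T z - g T z| * χ z
        ≤ (∫ z, |f 0 z - g 0 z|) + r n + ∫ s in Ioc 0 T, I n s := by
      simp only [hr, hI]
      linarith
    refine (ENNReal.ofReal_le_ofReal h4).trans (ENNReal.ofReal_add_le.trans ?_)
    exact add_le_add ENNReal.ofReal_add_le (hIle n)
  have hr1 := ENNReal.tendsto_ofReal hr0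
  rw [ENNReal.ofReal_zero] at hr1
  have hlim := (tendsto_const_nhds (x := ENNReal.ofReal (∫ z, |f 0 z - g 0 z|))).add hr1 |>.add
    (hJ0.add (tendsto_const_nhds
      (x := ENNReal.ofReal (14 * d * η) * ∫⁻ s in Ioc 0 T, S s ^ 2)))
  rw [add_zero, zero_add] at hlim
  exact ge_of_tendsto' hlim hfin

/-! ### Removal of the cutoff -/

lemma memLp_two_iff {μ : Measure ℝ} {a : ℝ → ENNReal} :
    MemLp a 2 μ ↔ AEStronglyMeasurable a μ ∧ ∫⁻ s, a s ^ 2 ∂μ < ⊤ := by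
  rw [MemLp, eLpNorm_lt_top_iff_lintegral_rpow_enorm_lt_top two_ne_zero ENNReal.ofNat_ne_top]
  simp

lemma LpTendsto.tendsto_eLpNorm {p : ENNReal} (hp : 1 ≤ p) {F : ℝ → Phase d → ℝ} {t : ℝ}
    (h : LpTendsto p (𝓝 t) F (F t)) :
    Tendsto (fun s => (eLpNorm (F s) p volume).toReal) (𝓝 t)
      (𝓝 (eLpNorm (F t) p volume).toReal) := by
  have h0 := (ENNReal.tendsto_toReal ENNReal.zero_ne_top).comp h.tendsto
  rw [tendsto_iff_dist_tendsto_zero]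
  refine tendsto_of_tendsto_of_tendsto_of_le_of_le tendsto_const_nhds h0
    (fun _ => dist_nonneg) fun s => ?_
  have hd : MemLp (fun z => F s z - F t z) p volume := (h.memLp s).sub (h.memLp t)
  have h1 : eLpNorm (F s) p volume
      ≤ eLpNorm (F t) p volume + eLpNorm (fun z => F s z - F t z) p volume := by
    refine le_trans (le_of_eq ?_) (eLpNorm_add_le (h.memLp t).1 hd.1 hp)
    congr 1; funext z; simp
  have h2 : eLpNorm (F t) p volume
      ≤ eLpNorm (F s) p volume + eLpNorm (fun z => F s z - F t z) p volume := by
    refine le_trans (le_of_eq ?_) (eLpNorm_sub_le (h.memLp s).1 hd.1 hp)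
    congr 1; funext z; simp
  have h1' := ENNReal.toReal_mono (ENNReal.add_ne_top.mpr ⟨(h.memLp t).2.ne, hd.2.ne⟩) h1
  have h2' := ENNReal.toReal_mono (ENNReal.add_ne_top.mpr ⟨(h.memLp s).2.ne, hd.2.ne⟩) h2
  rw [ENNReal.toReal_add (h.memLp t).2.ne hd.2.ne] at h1'
  rw [ENNReal.toReal_add (h.memLp s).2.ne hd.2.ne] at h2'
  rw [Real.dist_eq, abs_le]
  dsimp only [Function.comp_apply]
  constructor <;> linarith

lemma memLp_ofReal_of_continuous {b : ℝ → ℝ} (hb : Continuous b) (T : ℝ) :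
    MemLp (fun s => ENNReal.ofReal (b s)) 2 (volume.restrict (Ioc 0 T)) := by
  refine memLp_two_iff.mpr ⟨hb.measurable.ennreal_ofReal.aestronglyMeasurable, ?_⟩
  obtain ⟨M, hM⟩ := isCompact_Icc.exists_bound_of_continuousOn (s := Icc 0 T) hb.continuousOn
  calc ∫⁻ s in Ioc 0 T, ENNReal.ofReal (b s) ^ 2
      ≤ ∫⁻ _ in Ioc 0 T, ENNReal.ofReal M ^ 2 :=
        setLIntegral_mono measurable_const fun s hs => by
          gcongr
          exact (le_abs_self _).trans (hM s (Ioc_subset_Icc_self hs))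
    _ < ⊤ := by
        rw [setLIntegral_const, Real.volume_Ioc]
        exact ENNReal.mul_lt_top (ENNReal.pow_lt_top ENNReal.ofReal_lt_top) ENNReal.ofReal_lt_top

lemma aestronglyMeasurable_eLpNorm_slice {p : ENNReal} (hp0 : p ≠ 0) (hp : p ≠ ⊤)
    {u : ℝ → Phase d → ℝ} {μ : Measure ℝ}
    (hu : AEStronglyMeasurable (fun q : ℝ × Phase d => u q.1 q.2) (μ.prod volume)) :
    AEStronglyMeasurable (fun s => eLpNorm (u s) p volume) μ := by
  simp only [eLpNorm_eq_lintegral_rpow_enorm_toReal hp0 hp]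
  have h : AEMeasurable (fun s => ∫⁻ z, ‖u s z‖ₑ ^ p.toReal) μ :=
    AEMeasurable.lintegral_prod_right' (f := fun q : ℝ × Phase d => ‖u q.1 q.2‖ₑ ^ p.toReal)
      (hu.enorm.pow_const _)
  exact (h.pow_const _).aestronglyMeasurable

/-- The norms that control a solution at time `s` are bounded by a function of `s` that is square
integrable on bounded intervals. -/
lemma exists_memLp_two_bound {f : ℝ → Phase d → ℝ} (hf : ContL1L2 f) (hf' : RegularGradients f)
    {T : ℝ} (hT : 0 < T) :
    ∃ (u : ℝ → Fin d ⊕ Fin d → Phase d → ℝ) (a : ℝ → ENNReal),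
      MemLp a 2 (volume.restrict (Ioc 0 T)) ∧
      ∀ᵐ s ∂(volume.restrict (Ioc 0 T)), IsRegular (f s) (u s) ∧
        ∀ S : ENNReal, S ≠ ⊤ → 1 ≤ S → a s ≤ S → BoundedBy S.toReal (f s) (u s) := by
  have hD : ∀ k, HasRegularDeriv (dirDeriv k) f := by
    rintro (i | i)
    · rw [← partialX_eq]; exact (hf' i).1
    · rw [← partialP_eq]; exact (hf' i).2
  choose u hum hur hui using hD
  have m1 : MemLp (fun s => ENNReal.ofReal (eLpNorm (f (max s 0)) 1 volume).toReal) 2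
      (volume.restrict (Ioc 0 T)) :=
    memLp_ofReal_of_continuous
      (continuous_iff_continuousAt.mpr fun t => (hf.contL1 t).tendsto_eLpNorm le_rfl) T
  have m2 : MemLp (fun s => ENNReal.ofReal (eLpNorm (f (max s 0)) 2 volume).toReal) 2
      (volume.restrict (Ioc 0 T)) :=
    memLp_ofReal_of_continuous (continuous_iff_continuousAt.mpr fun t =>
      (hf.lpTendsto_two t).tendsto_eLpNorm one_le_two) T
  have hle : volume.restrict (Ioc 0 T) ≤ volume.restrict (Ioi (0 : ℝ)) :=
    Measure.restrict_mono Ioc_subset_Ioi_self le_rfl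
  have m3 : ∀ k, MemLp (fun s => eLpNorm (u k s) 1 volume) 2 (volume.restrict (Ioc 0 T)) :=
    fun k => memLp_two_iff.mpr ⟨(aestronglyMeasurable_eLpNorm_slice one_ne_zero
      ENNReal.one_ne_top (hum k)).mono_measure hle, (hui k T hT).1⟩
  have m4 : ∀ k, MemLp (fun s => eLpNorm (u k s) 2 volume) 2 (volume.restrict (Ioc 0 T)) :=
    fun k => memLp_two_iff.mpr ⟨(aestronglyMeasurable_eLpNorm_slice two_ne_zero
      ENNReal.ofNat_ne_top (hum k)).mono_measure hle, (hui k T hT).2⟩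
  refine ⟨fun s k => u k s, _, (m1.add m2).add ((memLp_finsetSum Finset.univ fun k _ => m3 k).add
    (memLp_finsetSum Finset.univ fun k _ => m4 k)), ?_⟩
  filter_upwards [ae_restrict_mem measurableSet_Ioc,
    ae_mono hle (ae_all_iff.mpr hur)] with s hs hr
  obtain ⟨c1, c2, -⟩ := hf s hs.1.le
  refine ⟨⟨memLp_one_iff_integrable.mp c1, c2, fun k => memLp_one_iff_integrable.mp (hr k).1,
    fun k => (hr k).2.1, fun k => (hr k).2.2⟩, fun S hS h1 ha => ?_⟩
  simp only [Pi.add_apply, max_eq_left hs.1.le, ENNReal.ofReal_toReal c1.2.ne,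
    ENNReal.ofReal_toReal c2.2.ne] at ha
  have hk : ∀ (p : ENNReal) k, eLpNorm (u k s) p volume ≤ ∑ k, eLpNorm (u k s) p volume :=
    fun p k => Finset.single_le_sum (f := fun k => eLpNorm (u k s) p volume)
      (fun _ _ => zero_le) (Finset.mem_univ k)
  refine ⟨?_, ?_, ENNReal.toReal_mono hS ?_, fun k => ?_, fun k => ENNReal.toReal_mono hS ?_⟩
  · rw [← ENNReal.toReal_one]; exact ENNReal.toReal_mono hS h1
  · rw [integral_abs_eq_toReal (memLp_one_iff_integrable.mp c1)]
    exact ENNReal.toReal_mono hS ((le_self_add.trans le_self_add).trans ha)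
  · exact (le_add_self.trans le_self_add).trans ha
  · rw [integral_abs_eq_toReal (memLp_one_iff_integrable.mp (hr k).1)]
    exact ENNReal.toReal_mono hS ((((hk 1 k).trans le_self_add).trans le_add_self).trans ha)
  · exact (((hk 2 k).trans le_add_self).trans le_add_self).trans ha

lemma CutoffBound.mono {C C' : ℝ} {χ : Phase d → ℝ} (h : CutoffBound C χ) (hC : C ≤ C') :
    CutoffBound C' χ :=
  ⟨h.nonneg.trans hC, h.integral_le.trans hC, fun k z => (h.abs_coord_le k z).trans hC,
    fun k => (h.integral_coord_le k).trans hC⟩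

lemma tendsto_integral_mul_logCutoff {h : Phase d → ℝ} (hh : Integrable h) :
    Tendsto (fun n : ℕ => ∫ z, |h z| * logCutoff (n + 1 : ℝ) z) atTop (𝓝 (∫ z, |h z|)) := by
  obtain ⟨c, -, hχ⟩ := exists_isCutoff_logCutoff (d := d)
  have hχ' : ∀ n : ℕ, IsCutoff (c / (n + 1)) (logCutoff (d := d) (n + 1 : ℝ)) :=
    fun n => hχ _ (by positivity)
  refine tendsto_integral_of_dominated_convergence (fun z => |h z|)
    (fun n => hh.abs.1.mul (hχ' n).isTest.continuous.aestronglyMeasurable) hh.abs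
    (fun n => Eventually.of_forall fun z => ?_) (Eventually.of_forall fun z => ?_)
  · rw [Real.norm_of_nonneg (mul_nonneg (abs_nonneg _) ((hχ' n).nonneg z))]
    exact mul_le_of_le_one_right (abs_nonneg _) ((hχ' n).le_one z)
  · refine tendsto_const_nhds.congr' ?_
    filter_upwards [tendsto_logCutoff z] with n hn
    rw [hn, mul_one]

/-- The contraction between the solutions at a positive time and at time zero: the limit of
`ofReal_integral_cutoff_le` when the cutoff is removed. -/
lemma ofReal_integral_abs_sub_le {κ T : ℝ} {f₀ g₀ : Phase d → ℝ} {f g : ℝ → Phase d → ℝ}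
    (hκ : |κ| ≤ 1) (hf : IsWeakSolution κ f₀ f) (hg : IsWeakSolution κ g₀ g)
    (hf' : RegularGradients f) (hg' : RegularGradients g) (hT : 0 < T) :
    ENNReal.ofReal (∫ z, |f T z - g T z|) ≤ ENNReal.ofReal (∫ z, |f 0 z - g 0 z|) := by
  obtain ⟨u, a, ha, hu⟩ := exists_memLp_two_bound hf.1 hf' hT
  obtain ⟨v, b, hb, hv⟩ := exists_memLp_two_bound hg.1 hg' hT
  -- the summand one makes `1 ≤ S`, as `BoundedBy` requires
  have hS := ((memLp_const_enorm (μ := volume.restrict (Ioc 0 T)) (p := 2) (c := (1 : ENNReal))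
    (by simp)).add ha).add hb
  set S : ℝ → ENNReal := ((fun _ => 1) + a) + b
  obtain ⟨hSm, hS2⟩ := memLp_two_iff.mp hS
  have hSfin : ∀ᵐ s ∂(volume.restrict (Ioc 0 T)), S s ≠ ⊤ := by
    filter_upwards [ae_lt_top' (hSm.aemeasurable.pow_const 2) hS2.ne] with s hs h
    simp [h] at hs
  have hreg : ∀ᵐ s ∂(volume.restrict (Ioc 0 T)), ∃ u v, IsRegular (f s) u ∧ IsRegular (g s) v ∧
      BoundedBy (S s).toReal (f s) u ∧ BoundedBy (S s).toReal (g s) v := by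
    filter_upwards [hu, hv, hSfin] with s hu hv hs
    have h1 : 1 ≤ S s := le_self_add.trans le_self_add
    exact ⟨u s, v s, hu.1, hv.1, hu.2 _ hs h1 (le_add_self.trans le_self_add),
      hv.2 _ hs h1 le_add_self⟩
  obtain ⟨c, hc, hχ⟩ := exists_isCutoff_logCutoff (d := d)
  have key : ∀ n : ℕ, ENNReal.ofReal (∫ z, |f T z - g T z| * logCutoff (n + 1 : ℝ) z)
      ≤ ENNReal.ofReal (∫ z, |f 0 z - g 0 z|)
        + ENNReal.ofReal (14 * d * (c / (n + 1))) * ∫⁻ s in Ioc 0 T, S s ^ 2 := fun n => by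
    have hχn := hχ (n + 1) (by positivity)
    obtain ⟨C, hC⟩ := exists_cutoffBound hχn.isTest
    exact ofReal_integral_cutoff_le hκ hf hg hT.le hχn (hC.mono (le_max_left C (c / (n + 1))))
      (by positivity) (le_max_right _ _) hSm.aemeasurable hS2.ne hreg
  have hi : Integrable fun z => f T z - g T z :=
    (memLp_one_iff_integrable.mp (hf.1 T hT.le).1).sub
      (memLp_one_iff_integrable.mp (hg.1 T hT.le).1)
  have l1 := ENNReal.tendsto_ofReal (tendsto_integral_mul_logCutoff hi)
  have l0 : Tendsto (fun n : ℕ => 14 * d * (c / ((n : ℝ) + 1))) atTop (𝓝 0) := by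
    have := (tendsto_one_div_add_atTop_nhds_zero_nat (𝕜 := ℝ)).const_mul (14 * d * c)
    rw [mul_zero] at this
    exact this.congr fun n => by ring
  have l2 := (ENNReal.Tendsto.mul_const (b := ∫⁻ s in Ioc 0 T, S s ^ 2)
    (ENNReal.tendsto_ofReal l0) (Or.inr hS2.ne)).const_add
    (ENNReal.ofReal (∫ z, |f 0 z - g 0 z|))
  rw [ENNReal.ofReal_zero, zero_mul, add_zero] at l2
  exact le_of_tendsto_of_tendsto' l1 l2 key

end QFP

theorem lemma3p4 (d : ℕ) (κ : ℝ) (hκ : κ = -1 ∨ κ = 0 ∨ κ = 1)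
    (f₀ g₀ : QFP.Phase d → ℝ) (f g : ℝ → QFP.Phase d → ℝ)
    (hf : QFP.IsWeakSolution κ f₀ f) (hg : QFP.IsWeakSolution κ g₀ g)
    (hf' : QFP.RegularGradients f) (hg' : QFP.RegularGradients g) :
    ∀ t : ℝ, 0 ≤ t →
      eLpNorm (f t - g t) 1 volume ≤ eLpNorm (f₀ - g₀) 1 volume := by
  intro t ht
  rw [← eLpNorm_congr_ae (hf.initial_ae_eq.sub hg.initial_ae_eq)]
  rcases ht.eq_or_lt with rfl | ht
  · exact le_rfl
  have hκ1 : |κ| ≤ 1 := by rcases hκ with rfl | rfl | rfl <;> simp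
  have e : ∀ s : ℝ, 0 ≤ s →
      ENNReal.ofReal (∫ z, |f s z - g s z|) = eLpNorm (f s - g s) 1 volume := fun s hs => by
    have m := (hf.1 s hs).1.sub (hg.1 s hs).1
    have := QFP.integral_abs_eq_toReal (memLp_one_iff_integrable.mp m)
    simp only [Pi.sub_apply] at this
    rw [this, ENNReal.ofReal_toReal m.2.ne]
  rw [← e t ht.le, ← e 0 le_rfl]
  exact QFP.ofReal_integral_abs_sub_le hκ1 hf hg hf' hg' ht
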